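/- Let $(X,\mu)$ be a standard probability space without atoms, and let $\mathrm{Aut}(X,\mu)$ be the group of bimeasurable bijections of $X$ preserving $\mu$, identified when they coincide almost everywhere. For an aperiodic $T\in\mathrm{Aut}(X,\mu)$ (almost every $T$-orbit is infinite) and $U\in\mathrm{Aut}(X,\mu)$ mapping almost every point into its own $T$-orbit, the $T$-cocycle of $U$ is the measurable map $c\colon X\to\mathbb Z$, unique up to null sets, with $U(x)=T^{c(x)}(x)$ for almost every $x$. The Shannon entropy of a measurable map $f\colon X\to\mathbb Z$ is $H(f)=-\sum_{i\in\mathbb Z}\mu(f^{-1}\{i\})\log\mu(f^{-1}\{i\})\in[0,+\infty]$. Two aperiodic transformations $T,U\in\mathrm{Aut}(X,\mu)$ are Shannon orbit equivalent if there is $S\in\mathrm{Aut}(X,\mu)$ such that $STS^{-1}$ and $U$ have the same orbits (at almost every point) and both the $U$-cocycle of $STS^{-1}$ and the $STS^{-1}$-cocycle of $U$ have finite Shannon entropy. They are flip-conjugate if there is $S\in\mathrm{Aut}(X,\mu)$ with $STS^{-1}=U$ or $ST^{-1}S^{-1}=U$ almost everywhere. **Theorem.** Let $T\in\mathrm{Aut}(X,\mu)$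 be ergodic, and assume that $T^n$ is ergodic for some $n\ge 2$. Then there exists $U\in\mathrm{Aut}(X,\mu)$ such that $T$ and $U$ are Shannon orbit equivalent but not flip-conjugate. In particular, there are ergodic measure-preserving transformations of a standard atomless probability space that are Shannon orbit equivalent but not flip-conjugate. -/

import Mathlib

open MeasureTheory
open scoped ENNReal

noncomputable section

namespace ShannonOE

variable {X : Type*} [MeasurableSpace X]

/-- The group of measure-preserving transformations of `(X, μ)`: bimeasurable bijections
`T : X → X` with `μ (T ⁻¹' A) = μ A` for all measurable `A`. Its elements are honest bijections;
two of them represent the same transformation when they agree almost everywhere, and every notion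
below is insensitive to changes on null sets. -/
def Aut (μ : Measure X) : Subgroup (Equiv.Perm X) where
  carrier := {T | MeasurePreserving (T : X → X) μ μ ∧ MeasurePreserving (T.symm : X → X) μ μ}
  mul_mem' := fun hS hT => ⟨hS.1.comp hT.1, hT.2.comp hS.2⟩
  one_mem' := ⟨MeasurePreserving.id μ, MeasurePreserving.id μ⟩
  inv_mem' := fun hT => ⟨hT.2, hT.1⟩

variable {μ : Measure X}

/-- The transformation, as a map `X → X`. -/
instance : CoeFun (Aut μ) (fun _ => X → X) := ⟨fun T => (T : Equiv.Perm X)⟩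

/-- The orbit `{T ^ k x : k ∈ ℤ}` of the point `x`. -/
def orbit (T : Aut μ) (x : X) : Set X := Set.range fun k : ℤ => (T ^ k) x

/-- Almost every orbit is infinite. -/
def Aperiodic (T : Aut μ) : Prop := ∀ᵐ x ∂μ, (orbit T x).Infinite

/-- `T` and `U` have the same orbits (up to a null set). -/
def SameOrbits (T U : Aut μ) : Prop := ∀ᵐ x ∂μ, orbit T x = orbit U x

/-- `c : X → ℤ` is the `T`-cocycle of `U`: a measurable map with `U x = T ^ (c x) x` for almost
every `x`. When `T` is aperiodic, `c` is unique up to a null set. -/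
def IsCocycle (T U : Aut μ) (c : X → ℤ) : Prop :=
  Measurable c ∧ ∀ᵐ x ∂μ, U x = (T ^ c x) x

/-- The Shannon entropy `H(f) = - ∑ i, μ (f ⁻¹ {i}) log μ (f ⁻¹ {i})` in `[0, ∞]` of a measurable map
`f` to a countable set; for a probability measure all the terms are nonnegative. -/
def shannonEntropy (μ : Measure X) {I : Type*} (f : X → I) : ℝ≥0∞ :=
  ∑' i, ENNReal.ofReal (-(μ.real (f ⁻¹' {i}) * Real.log (μ.real (f ⁻¹' {i}))))

/-- Shannon orbit equivalence of two aperiodic transformations: for some `S` in the group `Aut μ`,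
`S T S⁻¹` and `U` have the same orbits, and both the `U`-cocycle of `S T S⁻¹` and the
`S T S⁻¹`-cocycle of `U` have finite Shannon entropy. -/
def ShannonOrbitEquivalent (T U : Aut μ) : Prop :=
  Aperiodic T ∧ Aperiodic U ∧ ∃ S : Aut μ, SameOrbits (S * T * S⁻¹) U ∧
    (∃ c : X → ℤ, IsCocycle U (S * T * S⁻¹) c ∧ shannonEntropy μ c < ∞) ∧
    (∃ c : X → ℤ, IsCocycle (S * T * S⁻¹) U c ∧ shannonEntropy μ c < ∞)

/-- `S T = U S` almost everywhere for some `S` in the group `Aut μ`. -/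
def Conjugate (T U : Aut μ) : Prop := ∃ S : Aut μ, ∀ᵐ x ∂μ, S (T x) = U (S x)

/-- `T` or `T⁻¹` is conjugate to `U`. -/
def FlipConjugate (T U : Aut μ) : Prop := Conjugate T U ∨ Conjugate T⁻¹ U

end ShannonOE

end

/-! Ergodicity of the `n`-th power is invariant under flip-conjugacy. It therefore suffices to find
`U` with the same orbits as `T`, with both cocycles of finite entropy, and with `U ^ n` not ergodic.

Suppose `V` in the full group of `T` permutes almost every point in cycles of length `n` and has a
measurable fundamental domain `A`. Put `U = T_A V`, where `T_A` is the map induced by `T` on `A`,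
extended by the identity. Along a `V`-cycle `U` climbs from `A` like `V`, and on coming back to `A`
it applies `T_A`. Thus `U ^ n = T_A` on `A`, so `A` is invariant under `U ^ n` modulo null sets,
with measure strictly between 0 and 1 (`exists_tame_not_ergodic_pow`).

Entropy is controlled by integrability of the square root of the displacement (`Tame`,
`shannonEntropy_lt_top`), a condition stable under composition and inversion. The exponent 1/2 is
what makes a suitable `V` available (`exists_tame_cyclic`). `V` is built by exhaustion: a tower of
height `n` for the map induced on the residual set `R k` fills at least half of `R k`, and the
remainder is `R (k + 1)`. By Kac and Cauchy-Schwarz the return time to `R k` has square root of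
integral at most `μ (R k) ^ (1 / 2)`, which is summable in `k`; Kac alone would bound each return
time only by 1 in mean.

Conversely `x` and `T x` lie in `U`-columns over two points of `A` on one `T`-orbit. These differ by
a power `T_A ^ j`, that is `U ^ (n * j)`, with `|j|` at most their `T`-distance (`Tame.of_induced`).
-/

namespace ShannonOE

/-! ### Gluing measure-preserving maps and measurable selection. -/

section Basic

variable {X : Type*} [MeasurableSpace X] {μ : Measure X}

theorem measurable_of_mem_Aut {T : Equiv.Perm X} (hT : T ∈ Aut μ) : Measurable T := hT.1.measurable

theorem measurable_of_eqOn_cover {ι : Type*} [Countable ι] {D : ι → Set X}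
    (hD : ∀ j, MeasurableSet (D j)) (hcover : ∀ x, ∃ j, x ∈ D j) {h : ι → X → X}
    (hh : ∀ j, Measurable (h j)) {f : X → X} (hf : ∀ j, ∀ x ∈ D j, f x = h j x) :
    Measurable f := by
  intro E hE
  have : f ⁻¹' E = ⋃ j, D j ∩ h j ⁻¹' E := by
    ext x
    simp only [Set.mem_preimage, Set.mem_iUnion, Set.mem_inter_iff]
    constructor
    · intro hx
      obtain ⟨j, hj⟩ := hcover x
      exact ⟨j, hj, hf j x hj ▸ hx⟩
    · rintro ⟨j, hj, hx⟩
      rwa [hf j x hj]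
  rw [this]
  exact MeasurableSet.iUnion fun j => (hD j).inter (hh j hE)

theorem mem_Aut_of_eqOn_cover {ι : Type*} [Countable ι] {D : ι → Set X}
    (hD : ∀ j, MeasurableSet (D j)) (hcover : ∀ x, ∃ j, x ∈ D j) {h : ι → Equiv.Perm X}
    (hh : ∀ j, h j ∈ Aut μ) {V : Equiv.Perm X} (hV : ∀ j, ∀ x ∈ D j, V x = h j x) :
    V ∈ Aut μ := by
  rcases isEmpty_or_nonempty X with hX | ⟨⟨x₀⟩⟩
  · rw [Subsingleton.elim V 1]
    exact one_mem _
  have : Nonempty ι := ⟨(hcover x₀).choose⟩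
  have hVm : Measurable V := measurable_of_eqOn_cover hD hcover (fun j => (hh j).1.measurable) hV
  -- Inside `D j` the maps `V` and `h j` have the same images, so images under `V` inherit
  -- measurability from the inverse of `h j`.
  have himg : ∀ j, ∀ C ⊆ D j, (h j).symm ⁻¹' C = V.symm ⁻¹' C := by
    intro j C hC
    ext y
    simp only [Set.mem_preimage]
    constructor
    · intro hy
      have : V ((h j).symm y) = y := by rw [hV j _ (hC hy), Equiv.apply_symm_apply]
      rwa [← this, Equiv.symm_apply_apply]
    · intro hy
      have := hV j _ (hC hy)
      rw [Equiv.apply_symm_apply] at this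
      rwa [this, Equiv.symm_apply_apply]
  have hVsm : Measurable V.symm := by
    refine measurable_of_eqOn_cover (D := fun j => V.symm ⁻¹' (D j)) (h := fun j => (h j).symm)
      (fun j => ?_) (fun x => hcover (V.symm x)) (fun j => (hh j).2.measurable) fun j x hx => ?_
    · rw [← himg j _ subset_rfl]
      exact (hh j).2.measurable (hD j)
    · have := hV j _ hx
      rw [Equiv.apply_symm_apply] at this
      conv_rhs => rw [this]
      simp
  obtain ⟨e, he⟩ := exists_surjective_nat ι
  set D' : ℕ → Set X := disjointed fun n => D (e n) with hD'
  have hD'm : ∀ n, MeasurableSet (D' n) := fun n =>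
    MeasurableSet.disjointed (fun n => hD (e n)) n
  have hD'd : Pairwise (Function.onFun Disjoint D') := disjoint_disjointed _
  have hD'u : ⋃ n, D' n = Set.univ := by
    rw [hD', iUnion_disjointed]
    refine Set.eq_univ_of_forall fun x => ?_
    obtain ⟨j, hj⟩ := hcover x
    obtain ⟨n, rfl⟩ := he j
    exact Set.mem_iUnion.2 ⟨n, hj⟩
  have hD's : ∀ n, D' n ⊆ D (e n) := fun n => disjointed_subset _ n
  have hmp : MeasurePreserving V μ μ := by
    refine ⟨hVm, Measure.ext fun E hE => ?_⟩
    rw [Measure.map_apply hVm hE]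
    have h1 : V ⁻¹' E = ⋃ n, V ⁻¹' E ∩ D' n := by rw [← Set.inter_iUnion, hD'u, Set.inter_univ]
    have h2 : E = ⋃ n, E ∩ V.symm ⁻¹' D' n := by
      rw [← Set.inter_iUnion, ← Set.preimage_iUnion, hD'u, Set.preimage_univ, Set.inter_univ]
    rw [h1, measure_iUnion (fun i j hij => (hD'd hij).mono Set.inter_subset_right
      Set.inter_subset_right) fun n => (hVm hE).inter (hD'm n)]
    conv_rhs => rw [h2, measure_iUnion (fun i j hij => ((hD'd hij).preimage _).mono
      Set.inter_subset_right Set.inter_subset_right) fun n => hE.inter (hVsm (hD'm n))]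
    congr 1
    ext n
    rw [← (hh (e n)).1.measure_preimage (hE.inter (hVsm (hD'm n))).nullMeasurableSet]
    congr 1
    ext x
    simp only [Set.mem_inter_iff, Set.mem_preimage]
    constructor
    · rintro ⟨hx, hxD⟩
      rw [← hV _ x (hD's n hxD)]
      exact ⟨hx, by simpa using hxD⟩
    · rintro ⟨hx, hxD⟩
      have : x ∈ D' n := by
        have h3 : h (e n) x ∈ (h (e n)).symm ⁻¹' D' n := by
          rw [himg _ _ (hD's n)]
          exact hxD
        simpa using h3
      rw [hV _ x (hD's n this)]
      exact ⟨hx, this⟩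
  exact ⟨hmp, MeasurePreserving.symm (⟨V, hVm, hVsm⟩ : X ≃ᵐ X) hmp⟩

theorem exists_measurable_selection {ι : Type*} [Countable ι] [Nonempty ι] [MeasurableSpace ι]
    [MeasurableSingletonClass ι]
    {D : ι → Set X} (hD : ∀ j, MeasurableSet (D j)) :
    ∃ c : X → ι, Measurable c ∧ ∀ x, (∃ j, x ∈ D j) → x ∈ D (c x) := by
  classical
  obtain ⟨e, he⟩ := exists_surjective_nat ι
  -- The second alternative makes the search for a least index stop at points outside every `D j`.
  have hp : ∀ x, ∃ n, x ∈ D (e n) ∨ ¬ ∃ j, x ∈ D j := by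
    intro x
    by_cases h : ∃ j, x ∈ D j
    · obtain ⟨j, hj⟩ := h
      obtain ⟨n, rfl⟩ := he j
      exact ⟨n, Or.inl hj⟩
    · exact ⟨0, Or.inr h⟩
  refine ⟨fun x => e (Nat.find (hp x)), ?_, fun x hx => ?_⟩
  · refine (measurable_from_nat (f := e)).comp (measurable_find hp fun n => ?_)
    have h : {x | x ∈ D (e n) ∨ ¬ ∃ j, x ∈ D j} = D (e n) ∪ (⋃ j, D j)ᶜ := by
      ext x
      simp
    rw [h]
    exact (hD (e n)).union (MeasurableSet.iUnion hD).compl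
  · exact (Nat.find_spec (hp x)).resolve_right (not_not.2 hx)

end Basic

/-! ### Square-root displacement and finite entropy. -/

section Tame

variable {X : Type*} [MeasurableSpace X] {μ : Measure X}

/-- The weight `√|k|` of an integer. -/
noncomputable def weight (k : ℤ) : ℝ≥0∞ := (k.natAbs : ℝ≥0∞) ^ (1 / 2 : ℝ)

theorem weight_zero : weight 0 = 0 := by simp [weight]

theorem weight_one : weight 1 = 1 := by simp [weight]

theorem weight_neg (k : ℤ) : weight (-k) = weight k := by simp [weight]

theorem weight_mono {k l : ℤ} (h : k.natAbs ≤ l.natAbs) : weight k ≤ weight l :=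
  ENNReal.rpow_le_rpow (by exact_mod_cast h) (by norm_num)

theorem weight_add_le (k l : ℤ) : weight (k + l) ≤ weight k + weight l := by
  refine le_trans ?_ (ENNReal.rpow_add_le_add_rpow _ _ (by norm_num) (by norm_num))
  refine ENNReal.rpow_le_rpow ?_ (by norm_num)
  exact_mod_cast Int.natAbs_add_le k l

theorem weight_natCast_mul_le (n : ℕ) (k : ℤ) : weight (n * k) ≤ n * weight k := by
  induction n with
  | zero => simp [weight_zero]
  | succ n ih =>
    push_cast
    rw [add_mul, add_mul, one_mul, one_mul]
    exact (weight_add_le _ _).trans (by gcongr)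

theorem weight_natCast_le (n : ℕ) : weight n ≤ n := by
  simpa [weight_one] using weight_natCast_mul_le n 1

/-- `V` belongs a.e. to the full group of `T`, with a displacement whose square root is
integrable. -/
def Tame (μ : Measure X) (T V : Equiv.Perm X) : Prop :=
  ∃ s : X → ℝ≥0∞, Measurable s ∧ ∫⁻ x, s x ∂μ < ∞ ∧
    ∀ᵐ x ∂μ, ∃ k : ℤ, weight k ≤ s x ∧ V x = (T ^ k) x

theorem Tame.one (T : Equiv.Perm X) : Tame μ T 1 :=
  ⟨0, measurable_const, by simp, .of_forall fun _ => ⟨0, by simp [weight_zero], by simp⟩⟩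

theorem Tame.mul {T V W : Equiv.Perm X} (hW : W ∈ Aut μ) (hV : Tame μ T V) (hTW : Tame μ T W) :
    Tame μ T (V * W) := by
  obtain ⟨s, hs, hsi, hsV⟩ := hV
  obtain ⟨t, ht, hti, htW⟩ := hTW
  refine ⟨fun x => s (W x) + t x, (hs.comp hW.1.measurable).add ht, ?_, ?_⟩
  · rw [lintegral_add_right _ ht, hW.1.lintegral_comp hs]
    exact ENNReal.add_lt_top.2 ⟨hsi, hti⟩
  · filter_upwards [htW, hW.1.quasiMeasurePreserving.ae hsV] with x ⟨k, hk, hkx⟩ ⟨l, hl, hlx⟩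
    refine ⟨l + k, (weight_add_le _ _).trans (add_le_add hl hk), ?_⟩
    rw [zpow_add, Equiv.Perm.mul_apply, Equiv.Perm.mul_apply, hlx, hkx]

theorem Tame.pow {T V : Equiv.Perm X} (hV : V ∈ Aut μ) (h : Tame μ T V) (n : ℕ) :
    Tame μ T (V ^ n) := by
  induction n with
  | zero => exact Tame.one T
  | succ n ih => rw [pow_succ]; exact ih.mul hV h

theorem Tame.inv {T V : Equiv.Perm X} (hV : V ∈ Aut μ) (h : Tame μ T V) : Tame μ T V⁻¹ := by
  obtain ⟨s, hs, hsi, hsV⟩ := h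
  have hV' : MeasurePreserving (V⁻¹ : Equiv.Perm X) μ μ := hV.2
  refine ⟨fun x => s (V⁻¹ x), hs.comp hV'.measurable, ?_, ?_⟩
  · rwa [hV'.lintegral_comp hs]
  · filter_upwards [hV'.quasiMeasurePreserving.ae hsV] with x ⟨k, hk, hkx⟩
    refine ⟨-k, by rwa [weight_neg], ?_⟩
    rw [← Equiv.Perm.mul_apply, mul_inv_cancel, Equiv.Perm.one_apply] at hkx
    rw [zpow_neg, eq_comm, Equiv.Perm.inv_eq_iff_eq]
    exact hkx

theorem log_weight_le (k : ℤ) :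
    ENNReal.ofReal (2 * Real.log (1 + k.natAbs)) ≤ 4 * weight k := by
  have h0 : (0 : ℝ) ≤ k.natAbs := Nat.cast_nonneg _
  have h1 : 2 * Real.log (1 + k.natAbs) ≤ 4 * √(k.natAbs : ℝ) := by
    have h2 : (1 + k.natAbs : ℝ) ≤ (1 + √(k.natAbs : ℝ)) ^ 2 := by
      nlinarith [Real.sq_sqrt h0, Real.sqrt_nonneg (k.natAbs : ℝ)]
    have h3 := Real.log_le_log (by positivity) h2
    rw [Real.log_pow] at h3
    have h4 := Real.log_le_sub_one_of_pos (x := 1 + √(k.natAbs : ℝ)) (by positivity)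
    push_cast at h3
    linarith
  refine (ENNReal.ofReal_le_ofReal h1).trans_eq ?_
  rw [ENNReal.ofReal_mul (by norm_num), Real.sqrt_eq_rpow, weight,
    ← ENNReal.ofReal_rpow_of_nonneg h0 (by norm_num), ENNReal.ofReal_natCast]
  simp

/-- Compare the distribution `p` of `c` with the summable weights `q k = (1 + |k|)⁻²`. The
inequality `log y ≤ y - 1` at `y = q / p` gives `-p log p ≤ p log (1 / q) + q`, and `log (1 / q)` is
at most `4 √|k|`. -/
theorem shannonEntropy_lt_top [IsFiniteMeasure μ] {c : X → ℤ} (hc : Measurable c)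
    (h : ∫⁻ x, weight (c x) ∂μ < ∞) : shannonEntropy μ c < ∞ := by
  have hsum : Summable fun k : ℤ => ((1 + k.natAbs : ℝ) ^ 2)⁻¹ := by
    have h1 : Summable fun n : ℕ => ((1 + n : ℝ) ^ 2)⁻¹ := by
      have := (summable_nat_add_iff 1).2 (Real.summable_nat_pow_inv.2 (one_lt_two))
      refine this.congr fun n => ?_
      push_cast
      rw [add_comm]
    exact Summable.of_nat_of_neg (by simpa using h1) (by simpa using h1)
  have hterm : ∀ k : ℤ, ENNReal.ofReal (-(μ.real (c ⁻¹' {k}) * Real.log (μ.real (c ⁻¹' {k})))) ≤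
      4 * weight k * μ (c ⁻¹' {k}) + ENNReal.ofReal ((1 + k.natAbs : ℝ) ^ 2)⁻¹ := by
    intro k
    set p := μ.real (c ⁻¹' {k}) with hp
    have hp0 : 0 ≤ p := measureReal_nonneg
    have hk : (0 : ℝ) < 1 + k.natAbs := by positivity
    have key : -(p * Real.log p) ≤
        2 * Real.log (1 + k.natAbs) * p + ((1 + k.natAbs : ℝ) ^ 2)⁻¹ := by
      rcases hp0.eq_or_lt with h0 | hpos
      · rw [← h0]; simp only [zero_mul, neg_zero, mul_zero, zero_add]; positivity
      · have h1 := Real.log_le_sub_one_of_pos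
          (x := ((1 + k.natAbs : ℝ) ^ 2)⁻¹ / p) (by positivity)
        rw [Real.log_div (by positivity) hpos.ne', Real.log_inv, Real.log_pow] at h1
        have h2 := mul_le_mul_of_nonneg_left h1 hp0
        rw [mul_sub, mul_sub, mul_div_cancel₀ _ hpos.ne'] at h2
        push_cast at h2
        nlinarith
    refine (ENNReal.ofReal_le_ofReal key).trans ?_
    rw [ENNReal.ofReal_add (by have := Real.log_nonneg (x := 1 + k.natAbs) (by simp); positivity)
      (by positivity)]
    gcongr
    rw [ENNReal.ofReal_mul (by have := Real.log_nonneg (x := 1 + k.natAbs) (by simp); positivity)]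
    rw [hp, ofReal_measureReal]
    gcongr
    exact log_weight_le k
  have hint : ∑' k : ℤ, weight k * μ (c ⁻¹' {k}) = ∫⁻ x, weight (c x) ∂μ := by
    rw [← lintegral_map (f := weight) (measurable_of_countable _) hc, lintegral_countable']
    congr 1
    ext k
    rw [Measure.map_apply hc (measurableSet_singleton k)]
  refine (ENNReal.tsum_le_tsum hterm).trans_lt ?_
  simp_rw [mul_assoc]
  rw [ENNReal.tsum_add, ENNReal.tsum_mul_left, hint]
  refine ENNReal.add_lt_top.2 ⟨ENNReal.mul_lt_top (by simp) h, ?_⟩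
  exact hsum.tsum_ofReal_lt_top

theorem Tame.exists_cocycle [StandardBorelSpace X] [IsFiniteMeasure μ] {T U : Aut μ}
    (h : Tame μ (T : Equiv.Perm X) U) :
    ∃ c : X → ℤ, IsCocycle T U c ∧ shannonEntropy μ c < ∞ := by
  obtain ⟨s, hs, hsi, hsU⟩ := h
  obtain ⟨c, hc, hcx⟩ := exists_measurable_selection
    (D := fun k : ℤ => {x | weight k ≤ s x} ∩ {x | U x = (T ^ k) x}) fun k =>
      (measurableSet_le measurable_const hs).inter
        (measurableSet_eq_fun (measurable_of_mem_Aut U.2) (measurable_of_mem_Aut (T ^ k).2))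
  have hae : ∀ᵐ x ∂μ, weight (c x) ≤ s x ∧ U x = (T ^ c x) x := by
    filter_upwards [hsU] with x ⟨k, hk, hkx⟩
    exact hcx x ⟨k, hk, by simpa using hkx⟩
  exact ⟨c, ⟨hc, hae.mono fun x hx => hx.2⟩, shannonEntropy_lt_top hc <|
    (lintegral_mono_ae (hae.mono fun x hx => hx.1)).trans_lt hsi⟩

end Tame

/-! ### First-return maps, pointwise. -/

section Induced

variable {X : Type*}

/-- The points of `R` whose `T`-orbit meets `R` at arbitrarily large positive and negative times. -/
def returns (T : Equiv.Perm X) (R : Set X) : Set X :=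
  {x | x ∈ R ∧ ∀ N : ℤ, (∃ m, N ≤ m ∧ (T ^ m) x ∈ R) ∧ ∃ m, m ≤ N ∧ (T ^ m) x ∈ R}

theorem returns_subset (T : Equiv.Perm X) (R : Set X) : returns T R ⊆ R := fun _ hx => hx.1

theorem returns_inv (T : Equiv.Perm X) (R : Set X) : returns T⁻¹ R = returns T R := by
  have key : ∀ T : Equiv.Perm X, returns T R ⊆ returns T⁻¹ R := by
    rintro T x ⟨hx, h⟩
    refine ⟨hx, fun N => ?_⟩
    obtain ⟨⟨m, hm, hmx⟩, m', hm', hmx'⟩ := h (-N)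
    exact ⟨⟨-m', by lia, by simpa using hmx'⟩, -m, by lia, by simpa using hmx⟩
  exact (by simpa using key T⁻¹ : returns T⁻¹ R ⊆ returns T R).antisymm (key T)

theorem zpow_mem_returns {T : Equiv.Perm X} {R : Set X} {x : X} (hx : x ∈ returns T R) {k : ℤ}
    (hk : (T ^ k) x ∈ R) : (T ^ k) x ∈ returns T R := by
  refine ⟨hk, fun N => ?_⟩
  obtain ⟨⟨m, hm, hmx⟩, m', hm', hmx'⟩ := hx.2 (N + k)
  refine ⟨⟨m - k, by lia, ?_⟩, m' - k, by lia, ?_⟩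
  · rwa [← Equiv.Perm.mul_apply, ← zpow_add, sub_add_cancel]
  · rwa [← Equiv.Perm.mul_apply, ← zpow_add, sub_add_cancel]

open Classical in
/-- The first return time to `R`, extended by `0` off the recurrent part of `R`. -/
noncomputable def retTime (T : Equiv.Perm X) (R : Set X) (x : X) : ℕ :=
  if x ∈ returns T R then sInf {m : ℕ | 0 < m ∧ (T ^ m) x ∈ R} else 0

theorem retTime_of_notMem {T : Equiv.Perm X} {R : Set X} {x : X} (hx : x ∉ returns T R) :
    retTime T R x = 0 := if_neg hx

theorem retTime_spec {T : Equiv.Perm X} {R : Set X} {x : X} (hx : x ∈ returns T R) :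
    0 < retTime T R x ∧ (T ^ retTime T R x) x ∈ R := by
  rw [retTime, if_pos hx]
  refine Nat.sInf_mem (s := {m : ℕ | 0 < m ∧ (T ^ m) x ∈ R}) ?_
  obtain ⟨m, hm, hmx⟩ := (hx.2 1).1
  lift m to ℕ using by lia
  exact ⟨m, by lia, by simpa using hmx⟩

theorem retTime_le {T : Equiv.Perm X} {R : Set X} {x : X} {j : ℕ} (hj : 0 < j)
    (hjx : (T ^ j) x ∈ R) : retTime T R x ≤ j := by
  by_cases hx : x ∈ returns T R
  · rw [retTime, if_pos hx]
    exact Nat.sInf_le ⟨hj, hjx⟩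
  · simp [retTime_of_notMem hx]

theorem pow_retTime_mem {T : Equiv.Perm X} {R : Set X} {x : X} (hx : x ∈ returns T R) :
    (T ^ retTime T R x) x ∈ returns T R := by
  have := zpow_mem_returns hx (k := retTime T R x) (by simpa using (retTime_spec hx).2)
  simpa using this

/-- A shorter backward return would be a visit of the forward orbit of `x` to `R` before its first
return. This symmetry makes the induced map invertible. -/
theorem retTime_inv_pow_retTime {T : Equiv.Perm X} {R : Set X} {x : X} (hx : x ∈ returns T R) :
    retTime T⁻¹ R ((T ^ retTime T R x) x) = retTime T R x := by
  have hy := pow_retTime_mem hx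
  obtain ⟨h0, h1⟩ := retTime_spec hx
  refine le_antisymm (retTime_le h0 (by simpa using hx.1)) ?_
  rw [← returns_inv] at hy
  obtain ⟨h2, h3⟩ := retTime_spec hy
  by_contra! hlt
  set a := retTime T R x
  set b := retTime T⁻¹ R ((T ^ a) x)
  have h4 : (T ^ (a - b)) x ∈ R := by
    have : (T ^ a) x = (T ^ b) ((T ^ (a - b)) x) := by
      rw [← Equiv.Perm.mul_apply, ← pow_add]
      congr 2
      lia
    rw [this] at h3
    simpa using h3
  have := retTime_le (by lia) h4
  lia

/-- The map induced by `T` on `R`, extended by the identity. -/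
noncomputable def induced (T : Equiv.Perm X) (R : Set X) : Equiv.Perm X where
  toFun x := (T ^ retTime T R x) x
  invFun x := (T⁻¹ ^ retTime T⁻¹ R x) x
  left_inv x := by
    by_cases hx : x ∈ returns T R
    · beta_reduce
      rw [retTime_inv_pow_retTime hx]
      simp
    · have hx' : x ∉ returns T⁻¹ R := by rwa [returns_inv]
      simp [retTime_of_notMem hx, retTime_of_notMem hx']
  right_inv x := by
    by_cases hx : x ∈ returns T⁻¹ R
    · have := retTime_inv_pow_retTime hx
      rw [inv_inv] at this
      beta_reduce
      rw [this]
      simp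
    · have hx' : x ∉ returns T R := by rwa [← returns_inv]
      simp [retTime_of_notMem hx, retTime_of_notMem hx']

theorem induced_apply (T : Equiv.Perm X) (R : Set X) (x : X) :
    induced T R x = (T ^ retTime T R x) x := rfl

theorem induced_inv (T : Equiv.Perm X) (R : Set X) : induced T⁻¹ R = (induced T R)⁻¹ := by
  ext x
  change _ = (induced T R).symm x
  rfl

theorem induced_of_notMem {T : Equiv.Perm X} {R : Set X} {x : X} (hx : x ∉ returns T R) :
    induced T R x = x := by
  simp [induced_apply, retTime_of_notMem hx]

theorem induced_mem_returns {T : Equiv.Perm X} {R : Set X} {x : X} (hx : x ∈ returns T R) :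
    induced T R x ∈ returns T R := pow_retTime_mem hx

theorem induced_inv_mem_returns {T : Equiv.Perm X} {R : Set X} {x : X} (hx : x ∈ returns T R) :
    (induced T R)⁻¹ x ∈ returns T R := by
  rw [← returns_inv] at hx
  simpa [← induced_inv, returns_inv] using induced_mem_returns hx

theorem induced_mem {T : Equiv.Perm X} {R : Set X} {x : X} (hx : x ∈ R) :
    induced T R x ∈ R := by
  by_cases h : x ∈ returns T R
  · exact (induced_mem_returns h).1
  · rwa [induced_of_notMem h]

theorem induced_zpow_mem_returns {T : Equiv.Perm X} {R : Set X} {x : X} (hx : x ∈ returns T R)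
    (k : ℤ) : (induced T R ^ k) x ∈ returns T R := by
  induction k with
  | zero => simpa
  | succ k ih => rw [add_comm, zpow_add, zpow_one, Equiv.Perm.mul_apply]; exact induced_mem_returns ih
  | pred k ih =>
    rw [sub_eq_add_neg, add_comm, zpow_add, zpow_neg_one, Equiv.Perm.mul_apply]
    exact induced_inv_mem_returns ih

/-- The bound `p ≥ i` transfers freeness from `T` to the induced map. -/
theorem exists_induced_pow_eq {T : Equiv.Perm X} {R : Set X} {x : X} (hx : x ∈ returns T R)
    (i : ℕ) : ∃ p ≥ i, (induced T R ^ i) x = (T ^ p) x := by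
  induction i with
  | zero => exact ⟨0, le_rfl, rfl⟩
  | succ i ih =>
    obtain ⟨p, hp, hpx⟩ := ih
    have hi := induced_zpow_mem_returns hx i
    rw [zpow_natCast, hpx] at hi
    refine ⟨retTime T R ((T ^ p) x) + p, by have := (retTime_spec hi).1; lia, ?_⟩
    rw [pow_succ', Equiv.Perm.mul_apply, hpx, induced_apply, pow_add, Equiv.Perm.mul_apply]

/-- Peel off first returns one at a time; each consumes at least one unit of `T`-time, whence `j ≤
k`. -/
theorem exists_pow_eq_induced_pow {T : Equiv.Perm X} {R : Set X} (k : ℕ) :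
    ∀ {x : X}, x ∈ returns T R → (T ^ k) x ∈ R →
      ∃ j ≤ k, (T ^ k) x = (induced T R ^ j) x := by
  induction k using Nat.strong_induction_on with
  | _ k ih =>
    intro x hx hk
    rcases k.eq_zero_or_pos with rfl | h0
    · exact ⟨0, le_rfl, rfl⟩
    · have h1 := retTime_le h0 hk
      have h2 := (retTime_spec hx).1
      have h3 : (T ^ k) x = (T ^ (k - retTime T R x)) (induced T R x) := by
        rw [induced_apply, ← Equiv.Perm.mul_apply, ← pow_add, Nat.sub_add_cancel h1]
      obtain ⟨j, hj, hjx⟩ := ih (k - retTime T R x) (by lia) (induced_mem_returns hx) (h3 ▸ hk)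
      refine ⟨j + 1, by lia, ?_⟩
      rw [h3, hjx, pow_succ, Equiv.Perm.mul_apply]

theorem exists_zpow_eq_induced_zpow {T : Equiv.Perm X} {R : Set X} (k : ℤ) {x : X}
    (hx : x ∈ returns T R) (hk : (T ^ k) x ∈ R) :
    ∃ j : ℤ, j.natAbs ≤ k.natAbs ∧ (T ^ k) x = (induced T R ^ j) x := by
  obtain ⟨n, rfl | rfl⟩ := k.eq_nat_or_neg
  · obtain ⟨j, hj, hjx⟩ := exists_pow_eq_induced_pow n hx (by simpa using hk)
    exact ⟨j, by simpa using hj, by simpa using hjx⟩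
  · obtain ⟨j, hj, hjx⟩ := exists_pow_eq_induced_pow (T := T⁻¹) n (by rwa [returns_inv])
      (by simpa using hk)
    exact ⟨-j, by simpa using hj, by simpa [induced_inv] using hjx⟩

end Induced

/-! ### Recurrence, measurability of return times, and Kac's inequality. -/

section InducedMeasure

variable {X : Type*} [MeasurableSpace X] {μ : Measure X}

theorem measurableSet_zpow_mem {T : Equiv.Perm X} (hT : T ∈ Aut μ) {R : Set X}
    (hR : MeasurableSet R) (m : ℤ) : MeasurableSet {x | (T ^ m) x ∈ R} :=
  measurable_of_mem_Aut (zpow_mem hT m) hR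

theorem measurableSet_returns {T : Equiv.Perm X} (hT : T ∈ Aut μ) {R : Set X}
    (hR : MeasurableSet R) : MeasurableSet (returns T R) := by
  have : returns T R = R ∩ ⋂ N : ℤ, (⋃ m : ℤ, ⋃ _ : N ≤ m, {x | (T ^ m) x ∈ R}) ∩
      ⋃ m : ℤ, ⋃ _ : m ≤ N, {x | (T ^ m) x ∈ R} := by
    ext x
    simp [returns]
  rw [this]
  exact hR.inter (MeasurableSet.iInter fun N =>
    (MeasurableSet.iUnion fun m => MeasurableSet.iUnion fun _ =>
      measurableSet_zpow_mem hT hR m).inter (MeasurableSet.iUnion fun m =>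
        MeasurableSet.iUnion fun _ => measurableSet_zpow_mem hT hR m))

/-- Poincaré recurrence, applied to both `T` and `T⁻¹`. -/
theorem ae_mem_returns [IsFiniteMeasure μ] {T : Equiv.Perm X} (hT : T ∈ Aut μ) {R : Set X}
    (hR : MeasurableSet R) : ∀ᵐ x ∂μ, x ∈ R → x ∈ returns T R := by
  have key : ∀ T ∈ Aut μ, ∀ᵐ x ∂μ, x ∈ R → ∀ N : ℕ, ∃ m ≥ N, (T ^ m) x ∈ R := by
    intro T hT
    filter_upwards [hT.1.conservative.ae_mem_imp_frequently_image_mem hR.nullMeasurableSet]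
      with x hx hxR N
    obtain ⟨m, hm, hmx⟩ := Filter.frequently_atTop.1 (hx hxR) N
    exact ⟨m, hm, by rwa [Equiv.Perm.coe_pow]⟩
  filter_upwards [key T hT, key T⁻¹ (inv_mem hT)] with x h1 h2 hx
  refine ⟨hx, fun N => ?_⟩
  obtain ⟨m, hm, hmx⟩ := h1 hx N.natAbs
  obtain ⟨m', hm', hmx'⟩ := h2 hx N.natAbs
  exact ⟨⟨m, by lia, by simpa using hmx⟩, -m', by lia, by simpa using hmx'⟩

theorem measurable_retTime {T : Equiv.Perm X} (hT : T ∈ Aut μ) {R : Set X}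
    (hR : MeasurableSet R) : Measurable (retTime T R) := by
  refine measurable_of_Iic fun m => ?_
  have : retTime T R ⁻¹' Set.Iic m =
      (returns T R)ᶜ ∪ ⋃ j : ℕ, ⋃ _ : 0 < j ∧ j ≤ m, {x | (T ^ (j : ℤ)) x ∈ R} := by
    ext x
    simp only [Set.mem_preimage, Set.mem_Iic, Set.mem_union, Set.mem_compl_iff, Set.mem_iUnion,
      zpow_natCast, exists_prop, Set.mem_ofPred_eq]
    constructor
    · intro h
      by_cases hx : x ∈ returns T R
      · exact Or.inr ⟨_, ⟨(retTime_spec hx).1, h⟩, (retTime_spec hx).2⟩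
      · exact Or.inl hx
    · rintro (hx | ⟨j, ⟨h0, hj⟩, hjx⟩)
      · simp [retTime_of_notMem hx]
      · exact (retTime_le h0 hjx).trans hj
  rw [this]
  exact (measurableSet_returns hT hR).compl.union (MeasurableSet.iUnion fun j =>
    MeasurableSet.iUnion fun _ => measurableSet_zpow_mem hT hR j)

theorem induced_mem_Aut {T : Equiv.Perm X} (hT : T ∈ Aut μ) {R : Set X}
    (hR : MeasurableSet R) : induced T R ∈ Aut μ := by
  refine mem_Aut_of_eqOn_cover (D := fun n : ℕ => retTime T R ⁻¹' {n}) (h := fun n => T ^ n)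
    (fun n => measurable_retTime hT hR (measurableSet_singleton n)) (fun x => ⟨_, rfl⟩)
    (fun n => pow_mem hT n) fun n x hx => ?_
  rw [induced_apply, show retTime T R x = n from hx]

/-- Kac's inequality. -/
theorem lintegral_retTime_le {T : Equiv.Perm X} (hT : T ∈ Aut μ) {R : Set X}
    (hR : MeasurableSet R) : ∫⁻ x, (retTime T R x : ℝ≥0∞) ∂μ ≤ μ Set.univ := by
  have hE : ∀ j, MeasurableSet {x | j < retTime T R x} := fun j =>
    measurableSet_lt measurable_const (measurable_retTime hT hR)
  have h1 : ∀ x, (retTime T R x : ℝ≥0∞) =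
      ∑' j : ℕ, {x | j < retTime T R x}.indicator (fun _ => 1) x := by
    intro x
    rw [tsum_eq_sum (s := Finset.range (retTime T R x))]
    · rw [Finset.sum_congr rfl (g := fun _ => 1)]
      · simp
      · intro j hj
        simpa using hj
    · intro j hj
      simpa using hj
  simp_rw [h1]
  rw [lintegral_tsum fun j => (measurable_const.indicator (hE j)).aemeasurable]
  simp_rw [lintegral_indicator_const (hE _), one_mul]
  -- The image of `{j < retTime}` under `T ^ j` is the `j`-th level of the skyscraper over `R`;
  -- these levels are pairwise disjoint, so their measures sum to at most the total mass.
  have h2 : ∀ j : ℕ, μ {x | j < retTime T R x} =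
      μ ((T⁻¹ ^ j : Equiv.Perm X) ⁻¹' {x | j < retTime T R x}) := fun j =>
    ((pow_mem (inv_mem hT) j).1.measure_preimage (hE j).nullMeasurableSet).symm
  simp_rw [h2]
  rw [← measure_iUnion]
  · exact measure_mono (Set.subset_univ _)
  · have key : ∀ i j : ℕ, i < j → ∀ z, i < retTime T R ((T⁻¹ ^ i : Equiv.Perm X) z) →
        ¬ j < retTime T R ((T⁻¹ ^ j : Equiv.Perm X) z) := by
      intro i j hij z hi hj
      have hy : (T⁻¹ ^ i : Equiv.Perm X) z ∈ returns T R := by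
        by_contra h
        rw [retTime_of_notMem h] at hi
        exact absurd hi (Nat.not_lt_zero i)
      have : (T ^ (j - i)) ((T⁻¹ ^ j : Equiv.Perm X) z) = (T⁻¹ ^ i : Equiv.Perm X) z := by
        rw [← Equiv.Perm.mul_apply]
        congr 1
        have : j = (j - i) + i := by lia
        conv_lhs => rw [this, pow_add]
        simp
      have := retTime_le (T := T) (by lia : 0 < j - i) (this ▸ hy.1)
      lia
    intro i j hij
    refine Set.disjoint_left.2 fun z hi hj => ?_
    rcases lt_or_gt_of_ne hij with h | h
    · exact key i j h z hi hj
    · exact key j i h z hj hi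
  · exact fun j => (pow_mem (inv_mem hT) j).1.measurable (hE j)

/-- Cauchy-Schwarz against the indicator of `R`, outside which the return time is 0; Kac bounds the
other factor by 1. -/
theorem lintegral_weight_retTime_le [IsProbabilityMeasure μ] {T : Equiv.Perm X} (hT : T ∈ Aut μ)
    {R : Set X} (hR : MeasurableSet R) :
    ∫⁻ x, weight (retTime T R x) ∂μ ≤ μ R ^ (1 / 2 : ℝ) := by
  have hm : Measurable fun x => (retTime T R x : ℝ≥0∞) :=
    (measurable_of_countable (fun n : ℕ => (n : ℝ≥0∞))).comp (measurable_retTime hT hR)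
  have h1 : ∀ x, weight (retTime T R x) =
      ((fun x => (retTime T R x : ℝ≥0∞) ^ (1 / 2 : ℝ)) *
        R.indicator fun _ => (1 : ℝ≥0∞) : X → ℝ≥0∞) x := by
    intro x
    by_cases hx : x ∈ R
    · simp [weight, hx]
    · simp [weight, hx, retTime_of_notMem (fun h => hx (returns_subset T R h))]
  simp_rw [h1]
  refine (ENNReal.lintegral_mul_le_Lp_mul_Lq μ (p := 2) (q := 2) ⟨by norm_num, by norm_num,
    by norm_num⟩ (hm.pow_const _).aemeasurable
    (measurable_const.indicator hR).aemeasurable).trans ?_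
  have h2 : ∀ x, R.indicator (fun _ => (1 : ℝ≥0∞)) x ^ (2 : ℝ) = R.indicator (fun _ => 1) x := by
    intro x
    by_cases hx : x ∈ R <;> simp [hx]
  simp_rw [← ENNReal.rpow_mul, h2]
  rw [lintegral_indicator_const hR, one_mul]
  norm_num
  refine mul_le_of_le_one_left (by simp) ?_
  refine ENNReal.rpow_le_one ?_ (by norm_num)
  simpa using lintegral_retTime_le hT hR

end InducedMeasure

/-! ### Towers and marker sets. -/

section TowerSet

variable {X : Type*}

/-- The union of the first `n` levels of the tower with base `B`. -/
def tower (S : Equiv.Perm X) (B : Set X) (n : ℕ) : Set X :=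
  ⋃ i : Fin n, (S ^ (i : ℕ) : Equiv.Perm X) '' B

theorem mem_tower {S : Equiv.Perm X} {B : Set X} {n : ℕ} {x : X} :
    x ∈ tower S B n ↔ ∃ b ∈ B, ∃ i < n, (S ^ i) b = x := by
  simp only [tower, Set.mem_iUnion, Set.mem_image]
  constructor
  · rintro ⟨i, b, hb, rfl⟩
    exact ⟨b, hb, i, i.2, rfl⟩
  · rintro ⟨b, hb, i, hi, rfl⟩
    exact ⟨⟨i, hi⟩, b, hb, rfl⟩

end TowerSet

section Tower

variable {X : Type*} [MeasurableSpace X] {μ : Measure X}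

/-- Greedy construction: stage `j` adds the points of `C j` at `S`-distance at least `n` from
everything chosen so far. A point of `C j` is then either chosen or already close to a chosen point.
-/
theorem exists_marker_of_cover {S : Equiv.Perm X} (hS : ∀ i : ℤ, Measurable (S ^ i : Equiv.Perm X))
    {n : ℕ} (hn : 0 < n) {C : ℕ → Set X} (hC : ∀ j, MeasurableSet (C j))
    (hsep : ∀ j, ∀ x ∈ C j, ∀ i : ℕ, 0 < i → i < n → (S ^ i) x ∉ C j) :
    ∃ B ⊆ ⋃ j, C j, MeasurableSet B ∧ (∀ x ∈ B, ∀ i : ℕ, 0 < i → i < n → (S ^ i) x ∉ B) ∧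
      ∀ x ∈ ⋃ j, C j, ∃ i : ℤ, i.natAbs < n ∧ (S ^ i) x ∈ B := by
  let F : ℕ → Set X := fun j => Nat.rec ∅
    (fun j B => B ∪ {x | x ∈ C j ∧ ∀ i : ℤ, i.natAbs < n → (S ^ i) x ∉ B}) j
  have hFs : ∀ j, F (j + 1) = F j ∪ {x | x ∈ C j ∧ ∀ i : ℤ, i.natAbs < n → (S ^ i) x ∉ F j} :=
    fun j => rfl
  have hmono : Monotone F := monotone_nat_of_le_succ fun j => by
    rw [hFs]
    exact Set.subset_union_left
  have hFC : ∀ j, F j ⊆ ⋃ j, C j := by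
    intro j
    induction j with
    | zero => exact Set.empty_subset _
    | succ j ih =>
      rw [hFs]
      exact Set.union_subset ih fun x hx => Set.mem_iUnion.2 ⟨j, hx.1⟩
  have hFm : ∀ j, MeasurableSet (F j) := by
    intro j
    induction j with
    | zero => exact MeasurableSet.empty
    | succ j ih =>
      have : {x | x ∈ C j ∧ ∀ i : ℤ, i.natAbs < n → (S ^ i) x ∉ F j} =
          C j ∩ ⋂ i : ℤ, ⋂ _ : i.natAbs < n, (S ^ i : Equiv.Perm X) ⁻¹' (F j)ᶜ := by
        ext x
        simp
      rw [hFs, this]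
      exact ih.union ((hC j).inter (MeasurableSet.iInter fun i => MeasurableSet.iInter fun _ =>
        hS i ih.compl))
  have hFsep : ∀ j, ∀ x ∈ F j, ∀ i : ℕ, 0 < i → i < n → (S ^ i) x ∉ F j := by
    intro j
    induction j with
    | zero => exact fun x hx => absurd hx (Set.notMem_empty x)
    | succ j ih =>
      intro x hx i h0 hi hix
      rw [hFs] at hx hix
      rcases hx with hx | hx <;> rcases hix with hix | hix
      · exact ih x hx i h0 hi hix
      · exact hix.2 (-i) (by lia) (by simpa using hx)
      · exact hx.2 i (by lia) (by simpa using hix)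
      · exact hsep j x hx.1 i h0 hi hix.1
  refine ⟨⋃ j, F j, Set.iUnion_subset hFC, MeasurableSet.iUnion hFm, ?_, ?_⟩
  · intro x hx i h0 hi hix
    obtain ⟨j, hj⟩ := Set.mem_iUnion.1 hx
    obtain ⟨j', hj'⟩ := Set.mem_iUnion.1 hix
    exact hFsep (max j j') x (hmono (le_max_left _ _) hj) i h0 hi (hmono (le_max_right _ _) hj')
  · intro x hx
    obtain ⟨j, hj⟩ := Set.mem_iUnion.1 hx
    rcases Classical.em (∃ i : ℤ, i.natAbs < n ∧ (S ^ i) x ∈ F j) with h | h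
    · obtain ⟨i, hi, hix⟩ := h
      exact ⟨i, hi, Set.mem_iUnion.2 ⟨j, hix⟩⟩
    · push Not at h
      refine ⟨0, by simpa, Set.mem_iUnion.2 ⟨j + 1, ?_⟩⟩
      rw [hFs]
      exact Or.inr ⟨hj, h⟩

/-- A point differing from its next `n - 1` iterates has a basic open neighbourhood avoiding them,
so countably many sets, each disjoint from its translates, cover `G`. -/
theorem exists_marker [StandardBorelSpace X] {S : Equiv.Perm X}
    (hS : ∀ i : ℤ, Measurable (S ^ i : Equiv.Perm X)) {G : Set X} (hG : MeasurableSet G)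
    {n : ℕ} (hn : 0 < n)
    (hfree : ∀ x ∈ G, ∀ i : ℕ, 0 < i → i < n → (S ^ i) x ≠ x) :
    ∃ B ⊆ G, MeasurableSet B ∧ (∀ x ∈ B, ∀ i : ℕ, 0 < i → i < n → (S ^ i) x ∉ B) ∧
      ∀ x ∈ G, ∃ i : ℤ, i.natAbs < n ∧ (S ^ i) x ∈ B := by
  rcases isEmpty_or_nonempty X with hX | hX
  · exact ⟨∅, Set.empty_subset _, MeasurableSet.empty, fun x => isEmptyElim x,
      fun x => isEmptyElim x⟩
  let _ := upgradeStandardBorel X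
  have hbasis := TopologicalSpace.isBasis_countableBasis X
  obtain ⟨O, hO⟩ := (TopologicalSpace.countable_countableBasis X).exists_eq_range
    (by
      obtain ⟨x⟩ := hX
      obtain ⟨v, hv, -⟩ := hbasis.exists_subset_of_mem_open (Set.mem_univ x) isOpen_univ
      exact ⟨v, hv⟩)
  have hOo : ∀ j, IsOpen (O j) := fun j => hbasis.isOpen (hO ▸ Set.mem_range_self j)
  set C : ℕ → Set X := fun j =>
    {x | (x ∈ G ∧ x ∈ O j) ∧ ∀ i : ℕ, 0 < i → i < n → (S ^ (i : ℤ)) x ∉ O j} with hCdef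
  have hCm : ∀ j, MeasurableSet (C j) := by
    intro j
    have : C j = (G ∩ O j) ∩ ⋂ i : ℕ, ⋂ _ : 0 < i, ⋂ _ : i < n,
        (S ^ (i : ℤ) : Equiv.Perm X) ⁻¹' (O j)ᶜ := by
      ext x
      simp [hCdef]
      tauto
    rw [this]
    exact (hG.inter (hOo j).measurableSet).inter (MeasurableSet.iInter fun i =>
      MeasurableSet.iInter fun _ => MeasurableSet.iInter fun _ => hS i (hOo j).measurableSet.compl)
  have hCG : ⋃ j, C j = G := by
    refine (Set.iUnion_subset fun j x hx => hx.1.1).antisymm fun x hx => ?_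
    set E : Set X := (fun i : ℕ => (S ^ i) x) '' Set.Ioo 0 n
    have hE : IsClosed E := ((Set.finite_Ioo 0 n).image _).isClosed
    have hxE : x ∈ Eᶜ := by
      rintro ⟨i, hi, hix⟩
      exact hfree x hx i hi.1 hi.2 hix
    obtain ⟨v, hv, hxv, hvE⟩ := hbasis.exists_subset_of_mem_open hxE hE.isOpen_compl
    obtain ⟨j, rfl⟩ : v ∈ Set.range O := hO ▸ hv
    refine Set.mem_iUnion.2 ⟨j, ⟨hx, hxv⟩, fun i h0 hi hix => hvE hix ⟨i, ⟨h0, hi⟩, ?_⟩⟩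
    simp
  have := exists_marker_of_cover hS hn hCm fun j x hx i h0 hi hix =>
    hx.2 i h0 hi (by simpa using hix.1.2)
  rwa [hCG] at this

theorem measurableSet_image {S : Equiv.Perm X} (hS : S ∈ Aut μ) {B : Set X}
    (hB : MeasurableSet B) : MeasurableSet (S '' B) := by
  rw [Equiv.image_eq_preimage_symm]
  exact hS.2.measurable hB

theorem measure_image {S : Equiv.Perm X} (hS : S ∈ Aut μ) {B : Set X}
    (hB : MeasurableSet B) : μ (S '' B) = μ B := by
  rw [Equiv.image_eq_preimage_symm]
  exact hS.2.measure_preimage hB.nullMeasurableSet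

theorem measurableSet_tower {S : Equiv.Perm X} (hS : S ∈ Aut μ) {B : Set X}
    (hB : MeasurableSet B) (n : ℕ) : MeasurableSet (tower S B n) :=
  MeasurableSet.iUnion fun i => measurableSet_image (pow_mem hS (i : ℕ)) hB

theorem exists_tower [StandardBorelSpace X] [IsProbabilityMeasure μ] {T : Equiv.Perm X}
    (hT : T ∈ Aut μ) {n : ℕ} (hn : 0 < n) {R : Set X} (hR : MeasurableSet R)
    (hfree : ∀ x ∈ R, ∀ k : ℕ, 0 < k → (T ^ k) x ≠ x) :
    ∃ B, MeasurableSet B ∧ (∀ b ∈ B, ∀ i : ℕ, (induced T R ^ i) b ∈ R) ∧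
      (∀ b ∈ B, ∀ b' ∈ B, ∀ i < n, ∀ i' < n,
        (induced T R ^ i) b = (induced T R ^ i') b' → i = i' ∧ b = b') ∧
      2 * μ (R \ tower (induced T R) B n) ≤ μ R := by
  set S := induced T R with hSdef
  have hS : S ∈ Aut μ := induced_mem_Aut hT hR
  obtain ⟨B, hBG, hB, hsep, hcov⟩ := exists_marker (S := S)
    (fun i => (zpow_mem hS i).1.measurable) (measurableSet_returns hT hR) hn (by
      intro x hx i h0 _
      obtain ⟨p, hp, hpx⟩ := exists_induced_pow_eq hx i
      rw [hpx]
      exact hfree x hx.1 p (by lia))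
  have hret : ∀ b ∈ B, ∀ i : ℕ, (S ^ i) b ∈ R := fun b hb i => by
    simpa using (induced_zpow_mem_returns (hBG hb) i).1
  have hinj' : ∀ b ∈ B, ∀ b' ∈ B, ∀ i i' : ℕ, i' < n → i < i' → (S ^ i) b ≠ (S ^ i') b' := by
    intro b hb b' hb' i i' hi' hlt h
    refine hsep b' hb' (i' - i) (by lia) (by lia) ?_
    have : i' = i + (i' - i) := by lia
    rw [this, pow_add, Equiv.Perm.mul_apply] at h
    rwa [← (S ^ i).injective h]
  have hinj : ∀ b ∈ B, ∀ b' ∈ B, ∀ i < n, ∀ i' < n, (S ^ i) b = (S ^ i') b' →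
      i = i' ∧ b = b' := by
    intro b hb b' hb' i hi i' hi' h
    rcases lt_trichotomy i i' with hlt | rfl | hlt
    · exact absurd h (hinj' b hb b' hb' i i' hi' hlt)
    · exact ⟨rfl, (S ^ i).injective h⟩
    · exact absurd h.symm (hinj' b' hb' b hb i' i hi hlt)
  refine ⟨B, hB, hret, hinj, ?_⟩
  have htower : μ (tower S B n) = n * μ B := by
    rw [tower, measure_iUnion]
    · simp [tsum_fintype, measure_image (pow_mem hS _) hB]
    · intro i j hij
      refine Set.disjoint_left.2 ?_
      rintro _ ⟨b, hb, rfl⟩ ⟨b', hb', h⟩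
      exact hij (Fin.ext (hinj b hb b' hb' i i.2 j j.2 h.symm).1)
    · exact fun i => measurableSet_image (pow_mem hS _) hB
  -- The `2 * n - 1` translates of `B` by exponents `|i| < n` cover `R` almost everywhere, while the
  -- tower consists of `n` disjoint copies of `B`.
  have hcard : μ R ≤ 2 * μ (tower S B n) := by
    have h1 : μ R ≤ μ (⋃ i ∈ Finset.Ioo (-n : ℤ) n, (S ^ i : Equiv.Perm X) ⁻¹' B) := by
      refine measure_mono_ae ?_
      filter_upwards [ae_mem_returns hT hR] with x hx hxR
      obtain ⟨i, hi, hix⟩ := hcov x (hx hxR)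
      exact Set.mem_iUnion₂.2 ⟨i, Finset.mem_Ioo.2 (by lia), hix⟩
    refine h1.trans ((measure_biUnion_finset_le _ _).trans ?_)
    simp_rw [(zpow_mem hS _).1.measure_preimage hB.nullMeasurableSet]
    rw [Finset.sum_const, htower, nsmul_eq_mul, ← mul_assoc, Int.card_Ioo]
    gcongr
    exact_mod_cast (by lia : ((n : ℤ) - -n - 1).toNat ≤ 2 * n)
  have hsplit : μ (tower S B n) + μ (R \ tower S B n) = μ R := by
    rw [← measure_inter_add_sdiff R (measurableSet_tower hS hB n), Set.inter_eq_self_of_subset_right]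
    intro x hx
    obtain ⟨b, hb, i, hi, rfl⟩ := mem_tower.1 hx
    exact hret b hb i
  have hfin : μ R ≠ ∞ := measure_ne_top _ _
  refine (ENNReal.add_le_add_iff_left hfin).1 ?_
  calc μ R + 2 * μ (R \ tower S B n)
      ≤ 2 * μ (tower S B n) + 2 * μ (R \ tower S B n) := by gcongr
    _ = μ R + μ R := by rw [← mul_add, hsplit, two_mul]

end Tower

/-! ### Cyclic permutation of the levels of a family of towers. -/

section Cyclic

variable {X : Type*}

/-- A point of a tower has a unique address `(k, b, i)`; rotate the last coordinate and extend by
the identity. -/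
theorem exists_cyclic_perm {S : ℕ → Equiv.Perm X} {B : ℕ → Set X} {m : ℕ}
    (hinj : ∀ k k' : ℕ, ∀ b ∈ B k, ∀ b' ∈ B k', ∀ i < m + 1, ∀ i' < m + 1,
      (S k ^ i) b = (S k' ^ i') b' → k = k' ∧ i = i' ∧ b = b') :
    ∃ V : Equiv.Perm X, (∀ k, ∀ b ∈ B k, ∀ i < m, V ((S k ^ i) b) = (S k ^ (i + 1)) b) ∧
      (∀ k, ∀ b ∈ B k, V ((S k ^ m) b) = b) ∧
      ∀ x, (∀ k, x ∉ tower (S k) (B k) (m + 1)) → V x = x := by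
  classical
  let φ : (Σ k, B k) × Fin (m + 1) → X := fun p => (S p.1.1 ^ (p.2 : ℕ)) p.1.2
  have hφ : Function.Injective φ := by
    rintro ⟨⟨k, b, hb⟩, i⟩ ⟨⟨k', b', hb'⟩, i'⟩ h
    obtain ⟨rfl, hi, rfl⟩ := hinj k k' b hb b' hb' i i.2 i' i'.2 h
    rw [Fin.ext hi]
  let V : Equiv.Perm X := Equiv.Perm.extendDomain
    (Equiv.prodCongr (Equiv.refl (Σ k, B k)) (finRotate (m + 1))) (Equiv.ofInjective φ hφ)
  have hV : ∀ p, V (φ p) = φ (p.1, finRotate (m + 1) p.2) := fun p =>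
    Equiv.Perm.extendDomain_apply_image _ (Equiv.ofInjective φ hφ) p
  refine ⟨V, fun k b hb i hi => ?_, fun k b hb => ?_, fun x hx => ?_⟩
  · have := hV (⟨k, b, hb⟩, ⟨i, by lia⟩)
    rw [finRotate_of_lt hi] at this
    exact this
  · have := hV (⟨k, b, hb⟩, Fin.last m)
    rw [finRotate_last] at this
    exact this
  · refine Equiv.Perm.extendDomain_apply_not_subtype _ _ ?_
    rintro ⟨⟨⟨k, b, hb⟩, i⟩, rfl⟩
    exact hx k (mem_tower.2 ⟨b, hb, i, i.2, rfl⟩)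

/-- Bounds the jump from the top of a tower to its base. The descent does not need the summand `l =
0`; with it the same sum also bounds one step upwards. -/
theorem exists_induced_inv_pow_eq {T : Equiv.Perm X} {R : Set X} (x : X) (j : ℕ) :
    ∃ k : ℤ, ((induced T R)⁻¹ ^ j) x = (T ^ k) x ∧ weight k ≤
      ∑ l ∈ Finset.range (j + 1), weight (retTime T R (((induced T R)⁻¹ ^ l) x)) := by
  induction j with
  | zero => exact ⟨0, by simp, by simp [weight_zero]⟩
  | succ j ih =>
    obtain ⟨k, hk, hkw⟩ := ih
    set y := ((induced T R)⁻¹ ^ (j + 1)) x with hy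
    have h1 : induced T R y = (T ^ k) x := by
      rw [hy, pow_succ', ← Equiv.Perm.mul_apply, mul_inv_cancel_left, hk]
    refine ⟨-(retTime T R y) + k, ?_, ?_⟩
    · rw [zpow_add, Equiv.Perm.mul_apply, ← h1, induced_apply]
      simp
    · rw [Finset.sum_range_succ, add_comm]
      refine (weight_add_le _ _).trans ?_
      rw [weight_neg]
      exact add_le_add hkw le_rfl

end Cyclic

/-! ### Exhaustion by towers and the cyclic transformation `V`. -/

section Fundamental

variable {X : Type*} [MeasurableSpace X] {μ : Measure X}

theorem exists_towers [StandardBorelSpace X] [IsProbabilityMeasure μ] {T : Equiv.Perm X}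
    (hT : T ∈ Aut μ) (hfree : ∀ᵐ x ∂μ, ∀ k : ℕ, 0 < k → (T ^ k) x ≠ x) {n : ℕ} (hn : 0 < n) :
    ∃ R B : ℕ → Set X, (∀ k, MeasurableSet (R k)) ∧ (∀ k, MeasurableSet (B k)) ∧
      (∀ k, μ (R k) ≤ (2⁻¹ : ℝ≥0∞) ^ k) ∧
      (∀ k k' : ℕ, ∀ b ∈ B k, ∀ b' ∈ B k', ∀ i < n, ∀ i' < n,
        (induced T (R k) ^ i) b = (induced T (R k') ^ i') b' → k = k' ∧ i = i' ∧ b = b') ∧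
      ∀ᵐ x ∂μ, ∃ k, x ∈ tower (induced T (R k)) (B k) n := by
  set P : Set X := {x | ∀ k : ℕ, 0 < k → (T ^ k) x ≠ x} with hP
  have hPm : MeasurableSet P := by
    have : P = ⋂ k : ℕ, ⋂ _ : 0 < k, {x | (T ^ k) x = x}ᶜ := by
      ext x
      simp [hP]
    rw [this]
    exact MeasurableSet.iInter fun k => MeasurableSet.iInter fun _ =>
      (measurableSet_eq_fun (pow_mem hT k).1.measurable measurable_id).compl
  choose! base hbm hbR hbinj hbμ using fun (R : Set X) (h : MeasurableSet R ∧ R ⊆ P) =>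
    exists_tower hT hn h.1 fun x hx => h.2 hx
  let R : ℕ → Set X := fun k => Nat.rec P (fun _ R => R \ tower (induced T R) (base R) n) k
  have hRs : ∀ k, R (k + 1) = R k \ tower (induced T (R k)) (base (R k)) n := fun k => rfl
  have hR : ∀ k, MeasurableSet (R k) ∧ R k ⊆ P := by
    intro k
    induction k with
    | zero => exact ⟨hPm, subset_rfl⟩
    | succ k ih =>
      rw [hRs]
      exact ⟨ih.1.diff (measurableSet_tower (induced_mem_Aut hT ih.1) (hbm _ ih) n),
        Set.sdiff_subset.trans ih.2⟩
  have hanti : Antitone R := antitone_nat_of_succ_le fun k => by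
    rw [hRs]
    exact Set.sdiff_subset
  have hμ : ∀ k, μ (R k) ≤ (2⁻¹ : ℝ≥0∞) ^ k := by
    intro k
    induction k with
    | zero => simpa using prob_le_one
    | succ k ih =>
      rw [pow_succ, ← div_eq_mul_inv, ENNReal.le_div_iff_mul_le (by simp) (by simp), mul_comm]
      exact (hbμ _ (hR k)).trans ih
  have hdisj : ∀ k k' : ℕ, k < k' → ∀ b ∈ base (R k), ∀ b' ∈ base (R k'), ∀ i < n, ∀ i' < n,
      (induced T (R k) ^ i) b ≠ (induced T (R k') ^ i') b' := by
    intro k k' hlt b hb b' hb' i hi i' hi' h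
    have h1 := hanti (Nat.succ_le_of_lt hlt) (hbR _ (hR k') b' hb' i')
    rw [← h, Nat.succ_eq_add_one, hRs] at h1
    exact h1.2 (mem_tower.2 ⟨b, hb, i, hi, rfl⟩)
  refine ⟨R, fun k => base (R k), fun k => (hR k).1, fun k => hbm _ (hR k), hμ, ?_, ?_⟩
  · intro k k' b hb b' hb' i hi i' hi' h
    rcases lt_trichotomy k k' with hlt | rfl | hlt
    · exact absurd h (hdisj k k' hlt b hb b' hb' i hi i' hi')
    · exact ⟨rfl, hbinj _ (hR k) b hb b' hb' i hi i' hi' h⟩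
    · exact absurd h.symm (hdisj k' k hlt b' hb' b hb i' hi' i hi)
  · have hnull : μ (⋂ k, R k) = 0 := by
      refine le_antisymm (ge_of_tendsto' (ENNReal.tendsto_pow_atTop_nhds_zero_of_lt_one
        (ENNReal.inv_lt_one.2 (by norm_num : (1 : ℝ≥0∞) < 2))) fun k =>
          (measure_mono (Set.iInter_subset _ k)).trans (hμ k)) zero_le
    filter_upwards [hfree, measure_eq_zero_iff_ae_notMem.1 hnull] with x hx hxR
    by_contra! h
    refine hxR (Set.mem_iInter.2 fun k => ?_)
    induction k with
    | zero => exact hx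
    | succ k ih => exact ⟨ih, h k⟩

/-- A perm of order `m + 1` in the full group of `T`, with integrable square root of displacement
and with a measurable fundamental domain. -/
theorem exists_tame_cyclic [StandardBorelSpace X] [IsProbabilityMeasure μ] {T : Equiv.Perm X}
    (hT : T ∈ Aut μ) (hfree : ∀ᵐ x ∂μ, ∀ k : ℕ, 0 < k → (T ^ k) x ≠ x) (m : ℕ) :
    ∃ V ∈ Aut μ, Tame μ T V ∧ ∃ A, MeasurableSet A ∧
      (∀ a ∈ A, ∀ i : ℕ, 0 < i → i < m + 1 → (V ^ i) a ∉ A) ∧ (∀ a ∈ A, (V ^ (m + 1)) a = a) ∧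
      ∀ᵐ x ∂μ, ∃ a ∈ A, ∃ i < m + 1, (V ^ i) a = x := by
  obtain ⟨R, B, hR, hB, hμ, hinj, hcov⟩ := exists_towers hT hfree m.succ_pos
  set S : ℕ → Equiv.Perm X := fun k => induced T (R k) with hSdef
  have hS : ∀ k, S k ∈ Aut μ := fun k => induced_mem_Aut hT (hR k)
  obtain ⟨V, hVlt, hVlast, hVid⟩ := exists_cyclic_perm (S := S) hinj
  have hVpow : ∀ k, ∀ b ∈ B k, ∀ i < m + 1, (V ^ i) b = (S k ^ i) b := by
    intro k b hb i
    induction i with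
    | zero => intro _; rfl
    | succ i ih =>
      intro hi
      rw [pow_succ', Equiv.Perm.mul_apply, ih (by lia), hVlt k b hb i (by lia)]
  have hVlast' : ∀ k, ∀ x ∈ (S k ^ m : Equiv.Perm X) '' B k, V x = ((S k)⁻¹ ^ m) x := by
    rintro k _ ⟨b, hb, rfl⟩
    rw [hVlast k b hb]
    simp
  have hVlt' : ∀ k, ∀ i < m, ∀ x ∈ (S k ^ i : Equiv.Perm X) '' B k, V x = S k x := by
    rintro k i hi _ ⟨b, hb, rfl⟩
    rw [hVlt k b hb i hi, pow_succ', Equiv.Perm.mul_apply]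
  have hV : V ∈ Aut μ := by
    refine mem_Aut_of_eqOn_cover (ι := Option (ℕ × Fin (m + 1)))
      (D := fun o => o.elim (⋃ k, tower (S k) (B k) (m + 1))ᶜ
        fun p => (S p.1 ^ (p.2 : ℕ) : Equiv.Perm X) '' B p.1)
      (h := fun o => o.elim 1 fun p => if (p.2 : ℕ) < m then S p.1 else (S p.1)⁻¹ ^ m) ?_ ?_ ?_ ?_
    · rintro (_ | ⟨k, i⟩)
      · exact (MeasurableSet.iUnion fun k => measurableSet_tower (hS k) (hB k) _).compl
      · exact measurableSet_image (pow_mem (hS k) _) (hB k)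
    · intro x
      by_cases hx : x ∈ ⋃ k, tower (S k) (B k) (m + 1)
      · obtain ⟨k, hk⟩ := Set.mem_iUnion.1 hx
        obtain ⟨i, hi⟩ := Set.mem_iUnion.1 hk
        exact ⟨some (k, i), hi⟩
      · exact ⟨none, hx⟩
    · rintro (_ | ⟨k, i⟩)
      · exact one_mem _
      · change (if (i : ℕ) < m then S k else (S k)⁻¹ ^ m) ∈ Aut μ
        split_ifs
        · exact hS k
        · exact pow_mem (inv_mem (hS k)) m
    · rintro (_ | ⟨k, i⟩) x hx
      · exact hVid x fun k hk => hx (Set.mem_iUnion.2 ⟨k, hk⟩)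
      · change V x = (if (i : ℕ) < m then S k else (S k)⁻¹ ^ m : Equiv.Perm X) x
        split_ifs with hi
        · exact hVlt' k i hi x hx
        · obtain rfl : i = Fin.last m := Fin.ext (by have := i.2; simp; lia)
          exact hVlast' k x hx
  have hwm : ∀ k, Measurable fun x => weight (retTime T (R k) x) := fun k =>
    (measurable_of_countable fun n : ℕ => weight n).comp (measurable_retTime hT (hR k))
  have hτm : ∀ k (l : ℕ), Measurable fun x => weight (retTime T (R k) (((S k)⁻¹ ^ l) x)) :=
    fun k l => (hwm k).comp (pow_mem (inv_mem (hS k)) l).1.measurable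
  -- Summing over all towers gives a bound that does not depend on which tower contains `x`. The
  -- `k`-th term has integral at most `(m + 1) * 2 ^ (-k / 2)`.
  refine ⟨V, hV, ⟨fun x => ∑' k, ∑ l ∈ Finset.range (m + 1),
    weight (retTime T (R k) (((S k)⁻¹ ^ l) x)), ?_, ?_, ?_⟩, ⋃ k, B k, MeasurableSet.iUnion hB, ?_,
    ?_, ?_⟩
  · exact Measurable.tsum fun k => Finset.measurable_sum _ fun l _ => hτm k l
  · rw [lintegral_tsum fun k => (Finset.measurable_sum _ fun l _ => hτm k l).aemeasurable]
    have h1 : ∀ k, ∫⁻ x, ∑ l ∈ Finset.range (m + 1),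
        weight (retTime T (R k) (((S k)⁻¹ ^ l) x)) ∂μ ≤
          (m + 1 : ℕ) * ((2⁻¹ : ℝ≥0∞) ^ (1 / 2 : ℝ)) ^ k := by
      intro k
      rw [lintegral_finsetSum _ fun l _ => hτm k l]
      have h2 : ∀ l, ∫⁻ x, weight (retTime T (R k) (((S k)⁻¹ ^ l) x)) ∂μ ≤
          ((2⁻¹ : ℝ≥0∞) ^ (1 / 2 : ℝ)) ^ k := by
        intro l
        rw [(pow_mem (inv_mem (hS k)) l).1.lintegral_comp (hwm k)]
        refine (lintegral_weight_retTime_le hT (hR k)).trans ?_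
        refine (ENNReal.rpow_le_rpow (hμ k) (by norm_num)).trans_eq ?_
        rw [← ENNReal.rpow_natCast, ← ENNReal.rpow_natCast, ← ENNReal.rpow_mul,
          ← ENNReal.rpow_mul, mul_comm]
      refine (Finset.sum_le_sum fun l _ => h2 l).trans_eq ?_
      simp
    refine (ENNReal.tsum_le_tsum h1).trans_lt ?_
    rw [ENNReal.tsum_mul_left, ENNReal.tsum_geometric]
    refine ENNReal.mul_lt_top (by simp) (ENNReal.inv_lt_top.2 (tsub_pos_of_lt ?_))
    exact ENNReal.rpow_lt_one (by simp) (by norm_num)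
  · filter_upwards [hcov] with x ⟨k, hk⟩
    obtain ⟨b, hb, i, hi, hbx⟩ := mem_tower.1 hk
    have hle := ENNReal.le_tsum (f := fun k => ∑ l ∈ Finset.range (m + 1),
      weight (retTime T (R k) (((S k)⁻¹ ^ l) x))) k
    rcases (Nat.lt_succ_iff.1 hi).lt_or_eq with hlt | heq
    · refine ⟨retTime T (R k) x, le_trans ?_ hle, ?_⟩
      · rw [Finset.sum_range_succ', pow_zero, Equiv.Perm.one_apply]
        exact le_add_self
      · rw [hVlt' k i hlt x ⟨b, hb, hbx⟩, hSdef, induced_apply, zpow_natCast]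
    · rw [heq] at hbx
      obtain ⟨j, hj, hjw⟩ : ∃ j : ℤ, ((S k)⁻¹ ^ m) x = (T ^ j) x ∧ weight j ≤
          ∑ l ∈ Finset.range (m + 1), weight (retTime T (R k) (((S k)⁻¹ ^ l) x)) :=
        exists_induced_inv_pow_eq x m
      have hVx := hVlast' k x ⟨b, hb, hbx⟩
      exact ⟨j, le_trans hjw hle, hVx.trans hj⟩
  · intro a ha i h0 hi hia
    obtain ⟨k, hk⟩ := Set.mem_iUnion.1 ha
    obtain ⟨k', hk'⟩ := Set.mem_iUnion.1 hia
    rw [hVpow k a hk i hi] at hk'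
    have := (hinj k k' a hk _ hk' i hi 0 (by lia) rfl).2.1
    lia
  · intro a ha
    obtain ⟨k, hk⟩ := Set.mem_iUnion.1 ha
    rw [pow_succ', Equiv.Perm.mul_apply, hVpow k a hk m (by lia), hVlast k a hk]
  · filter_upwards [hcov] with x ⟨k, hk⟩
    obtain ⟨b, hb, i, hi, rfl⟩ := mem_tower.1 hk
    exact ⟨b, Set.mem_iUnion.2 ⟨k, hb⟩, i, hi, hVpow k b hb i hi⟩

end Fundamental

/-! ### Composing `V` with the map induced on its fundamental domain. -/

section InducedMul

variable {X : Type*}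

/-- Strictly between two visits of the `V`-cycle to `A` the induced map acts trivially; it acts only
when the cycle closes up, at time `m + 1`. -/
theorem pow_induced_mul_eq {T V : Equiv.Perm X} {A : Set X} {m : ℕ}
    (hVA : ∀ a ∈ A, ∀ i : ℕ, 0 < i → i < m + 1 → (V ^ i) a ∉ A)
    (hVm : ∀ a ∈ A, (V ^ (m + 1)) a = a) :
    (∀ a ∈ A, ∀ i < m + 1, ((induced T A * V) ^ i) a = (V ^ i) a) ∧
    ∀ a ∈ A, ((induced T A * V) ^ (m + 1)) a = induced T A a := by
  have h1 : ∀ a ∈ A, ∀ i < m + 1, ((induced T A * V) ^ i) a = (V ^ i) a := by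
    intro a ha i
    induction i with
    | zero => intro _; rfl
    | succ i ih =>
      intro hi
      rw [pow_succ', Equiv.Perm.mul_apply, ih (by lia), Equiv.Perm.mul_apply,
        ← Equiv.Perm.mul_apply V, ← pow_succ']
      exact induced_of_notMem fun h => hVA a ha (i + 1) (by lia) hi (returns_subset T A h)
  refine ⟨h1, fun a ha => ?_⟩
  rw [pow_succ', Equiv.Perm.mul_apply, h1 a ha m (by lia), Equiv.Perm.mul_apply,
    ← Equiv.Perm.mul_apply V, ← pow_succ', hVm a ha]

end InducedMul

/-! ### Tameness in both directions, and non-ergodicity of `U ^ n`. -/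

section Suspension

variable {X : Type*} [MeasurableSpace X] {μ : Measure X}

theorem Tame.induced [IsProbabilityMeasure μ] {T : Equiv.Perm X} (hT : T ∈ Aut μ) {R : Set X}
    (hR : MeasurableSet R) : Tame μ T (induced T R) :=
  ⟨fun x => weight (retTime T R x),
    (measurable_of_countable fun n : ℕ => weight n).comp (measurable_retTime hT hR),
    (lintegral_weight_retTime_le hT hR).trans_lt
      (ENNReal.rpow_lt_top_of_nonneg (by norm_num) (measure_ne_top _ _)),
    .of_forall fun x => ⟨_, le_rfl, by rw [induced_apply, zpow_natCast]⟩⟩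

/-- If `U ^ n` induces on `A` the same map as `T`, and every point is close to `A` both along `T`
and along `U`, then `T` has tame displacement along `U`. -/
theorem Tame.of_induced [IsProbabilityMeasure μ] {T U : Equiv.Perm X} (hT : T ∈ Aut μ)
    (hU : U ∈ Aut μ) (hTU : Tame μ T U) {A : Set X} (hA : MeasurableSet A) {n : ℕ}
    (hUA : ∀ a ∈ returns T A, (U ^ n) a = ShannonOE.induced T A a)
    (hcov : ∀ᵐ x ∂μ, ∃ a ∈ A, ∃ i < n, (U ^ i) a = x) : Tame μ U T := by
  have hpow : ∀ i : ℕ, Tame μ T (U⁻¹ ^ i) := (hTU.inv hU).pow (inv_mem hU)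
  choose s hs hsi hsU using hpow
  have hUW : ∀ (j : ℤ), ∀ a ∈ returns T A,
      (U ^ (n * j)) a = (ShannonOE.induced T A ^ j) a := by
    have hnat : ∀ j : ℕ, ∀ a ∈ returns T A,
        (U ^ (n * j)) a = (ShannonOE.induced T A ^ j) a := by
      intro j
      induction j with
      | zero => intro a _; simp
      | succ j ih =>
        intro a ha
        rw [mul_add, mul_one, pow_add, Equiv.Perm.mul_apply, hUA a ha,
          ih _ (induced_mem_returns ha), pow_succ, Equiv.Perm.mul_apply]
    intro j a ha
    obtain ⟨p, rfl | rfl⟩ := j.eq_nat_or_neg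
    · exact_mod_cast hnat p a ha
    · have h1 := hnat p _ (induced_zpow_mem_returns ha (-p))
      rw [mul_neg, zpow_neg, Equiv.Perm.inv_eq_iff_eq]
      have h2 : (ShannonOE.induced T A ^ p) ((ShannonOE.induced T A ^ (-p : ℤ)) a) = a := by simp
      rw [h2] at h1
      exact_mod_cast h1.symm
  set t : X → ℝ≥0∞ := fun x => ∑ i ∈ Finset.range n, s i x with ht
  have htm : Measurable t := Finset.measurable_sum _ fun i _ => hs i
  have hti : ∫⁻ x, t x ∂μ < ∞ := by
    rw [ht, lintegral_finsetSum _ fun i _ => hs i]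
    exact ENNReal.sum_lt_top.2 fun i _ => hsi i
  have hst : ∀ i < n, ∀ x, s i x ≤ t x := fun i hi x =>
    Finset.single_le_sum (f := fun i => s i x) (fun _ _ => zero_le) (Finset.mem_range.2 hi)
  -- The base of the `U`-column through `x` is a recurrent point `T ^ k x` of `A`, at height `i`
  -- below `x`, and `t` controls `k`.
  have hgood : ∀ᵐ x ∂μ, ∃ i < n, ∃ k : ℤ, weight k ≤ t x ∧ (T ^ k) x ∈ returns T A ∧
      (U ^ i) ((T ^ k) x) = x := by
    have hret : ∀ᵐ x ∂μ, ∀ i : ℕ, (U⁻¹ ^ i) x ∈ A → (U⁻¹ ^ i) x ∈ returns T A :=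
      ae_all_iff.2 fun i =>
        (pow_mem (inv_mem hU) i).1.quasiMeasurePreserving.ae (ae_mem_returns hT hA)
    filter_upwards [hcov, hret, ae_all_iff.2 hsU] with x ⟨a, ha, i, hi, hax⟩ hxr hxs
    obtain ⟨k, hk, hkx⟩ := hxs i
    have hxa : (U⁻¹ ^ i) x = a := by rw [← hax]; simp
    have har := hxr i (hxa ▸ ha)
    refine ⟨i, hi, k, hk.trans (hst i hi x), hkx ▸ har, ?_⟩
    rw [← hkx, hxa, hax]
  have htT : Measurable fun x => t (T x) := htm.comp hT.1.measurable
  have ht1 : Measurable fun x => t x + 1 := htm.add measurable_const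
  have htT1 : Measurable fun x => t x + 1 + t (T x) := ht1.add htT
  have hpow_add : ∀ (i i' : ℕ) (l : ℤ) (y : X),
      (U ^ (i' - i + l : ℤ)) ((U ^ i) y) = (U ^ i') ((U ^ l) y) := by
    intro i i' l y
    rw [← zpow_natCast, ← zpow_natCast, ← Equiv.Perm.mul_apply, ← Equiv.Perm.mul_apply,
      ← zpow_add, ← zpow_add]
    congr 2
    ring
  -- The first `n` absorbs the height difference `i' - i`. The rest bounds the `n * j` steps between
  -- the two bases, with `|j| ≤ |k' + 1 - k|`.
  refine ⟨fun x => n + n * (t x + 1 + t (T x)),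
    measurable_const.add (measurable_const.mul htT1), ?_, ?_⟩
  · rw [lintegral_add_left measurable_const, lintegral_const_mul _ htT1,
      lintegral_add_left ht1, lintegral_add_left htm, hT.1.lintegral_comp htm]
    simp only [lintegral_const, measure_univ, mul_one]
    finiteness
  · filter_upwards [hgood, hT.1.quasiMeasurePreserving.ae hgood]
      with x ⟨i, hi, k, hk, hkr, hkx⟩ ⟨i', hi', k', hk', hkr', hkx'⟩
    have h1 : (T ^ (k' + 1 - k)) ((T ^ k) x) = (T ^ k') (T x) := by
      rw [← Equiv.Perm.mul_apply, ← zpow_add, sub_add_cancel, zpow_add_one, Equiv.Perm.mul_apply]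
    obtain ⟨j, hj, hjx⟩ := exists_zpow_eq_induced_zpow (k' + 1 - k) hkr (h1 ▸ hkr'.1)
    refine ⟨(i' - i) + n * j, ?_, ?_⟩
    · refine (weight_add_le _ _).trans (add_le_add ?_ ?_)
      · refine (weight_mono (l := n) (by lia)).trans (weight_natCast_le n)
      · refine (weight_natCast_mul_le n j).trans ?_
        gcongr
        refine (weight_mono hj).trans ?_
        rw [sub_eq_add_neg]
        refine (weight_add_le _ _).trans ?_
        rw [weight_neg, add_comm, add_assoc, add_comm 1]
        refine add_le_add hk ((weight_add_le _ _).trans ?_)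
        rw [weight_one]
        exact add_le_add hk' le_rfl
    · rw [← hkx', ← h1, hjx, ← hUW j _ hkr, ← hpow_add i, hkx]

theorem exists_tame_not_ergodic_pow [StandardBorelSpace X] [IsProbabilityMeasure μ]
    {T : Equiv.Perm X} (hT : T ∈ Aut μ) (hfree : ∀ᵐ x ∂μ, ∀ k : ℕ, 0 < k → (T ^ k) x ≠ x)
    {n : ℕ} (hn : 2 ≤ n) :
    ∃ U ∈ Aut μ, Tame μ T U ∧ Tame μ U T ∧ ∃ A, MeasurableSet A ∧ μ A ≠ 0 ∧ μ Aᶜ ≠ 0 ∧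
      (U ^ n : Equiv.Perm X) ⁻¹' A =ᵐ[μ] A := by
  obtain ⟨m, rfl⟩ : ∃ m, n = m + 1 := ⟨n - 1, by lia⟩
  obtain ⟨V, hV, hTV, A, hA, hVA, hVm, hcov⟩ := exists_tame_cyclic hT hfree m
  have hW := induced_mem_Aut hT hA
  obtain ⟨hUi, hUm⟩ := pow_induced_mul_eq (T := T) hVA hVm
  set U := induced T A * V
  have hU : U ∈ Aut μ := mul_mem hW hV
  have hTU : Tame μ T U := (Tame.induced hT hA).mul hV hTV
  have hcovU : ∀ᵐ x ∂μ, ∃ a ∈ A, ∃ i < m + 1, (U ^ i) a = x := by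
    filter_upwards [hcov] with x ⟨a, ha, i, hi, hax⟩
    exact ⟨a, ha, i, hi, by rw [hUi a ha i hi, hax]⟩
  have hAne : μ A ≠ 0 := by
    intro h0
    have h1 : ∀ᵐ x ∂μ, ∀ i : ℕ, (V⁻¹ ^ i) x ∉ A := ae_all_iff.2 fun i =>
      (pow_mem (inv_mem hV) i).1.quasiMeasurePreserving.ae (measure_eq_zero_iff_ae_notMem.1 h0)
    obtain ⟨x, ⟨a, ha, i, hi, rfl⟩, hx⟩ := (hcov.and h1).exists
    exact hx i (by simpa using ha)
  refine ⟨U, hU, hTU, hTU.of_induced hT hU hA (fun a ha => hUm a ha.1) hcovU, A, hA, hAne, ?_, ?_⟩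
  -- Since `n ≥ 2`, `V` maps `A` into its complement, so a null complement would force `A` to be
  -- null.
  · intro h0
    refine hAne (measure_mono_null (t := V ⁻¹' Aᶜ) (fun a ha => ?_) ?_)
    · have := hVA a ha 1 one_pos (by lia)
      rwa [pow_one] at this
    · rw [hV.1.measure_preimage hA.compl.nullMeasurableSet, h0]
  · have hsub : A ⊆ (U ^ (m + 1) : Equiv.Perm X) ⁻¹' A := fun a ha => by
      rw [Set.mem_preimage, hUm a ha]
      exact induced_mem ha
    exact (ae_eq_of_subset_of_measure_ge hsub
      ((pow_mem hU _).1.measure_preimage hA.nullMeasurableSet).le hA.nullMeasurableSet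
      (measure_ne_top _ _)).symm

end Suspension

/-! ### Orbit equivalence, the conjugacy invariant, and freeness. -/

section Orbits

variable {X : Type*} [MeasurableSpace X] {μ : Measure X}

theorem Tame.ae_orbit_subset {T U : Aut μ} (h : Tame μ (T : Equiv.Perm X) U) :
    ∀ᵐ x ∂μ, orbit U x ⊆ orbit T x := by
  obtain ⟨s, -, -, hs⟩ := h
  have h1 : ∀ᵐ x ∂μ, ∃ k : ℤ, U x = (T ^ k) x := hs.mono fun x ⟨k, _, hk⟩ => ⟨k, by simpa using hk⟩
  have h2 : ∀ᵐ x ∂μ, ∀ j : ℤ, ∃ k : ℤ, U ((U ^ j) x) = (T ^ k) ((U ^ j) x) :=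
    ae_all_iff.2 fun j => ((U ^ j).2).1.quasiMeasurePreserving.ae h1
  filter_upwards [h2] with x hx
  have hmem : ∀ {y z : X}, (∃ k : ℤ, z = (T ^ k) y) → (y ∈ orbit T x ↔ z ∈ orbit T x) := by
    rintro y _ ⟨k, rfl⟩
    constructor
    · rintro ⟨l, rfl⟩
      exact ⟨k + l, by simp [zpow_add]⟩
    · rintro ⟨l, hl⟩
      refine ⟨-k + l, ?_⟩
      have hl' : (T ^ l) x = (T ^ k) y := hl
      simp only [zpow_add, Subgroup.coe_mul, Equiv.Perm.mul_apply]
      rw [hl']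
      simp
  have hstep : ∀ j : ℤ, (U ^ j) x ∈ orbit T x ↔ (U ^ (j + 1)) x ∈ orbit T x := by
    intro j
    rw [hmem (hx j), add_comm, zpow_add, zpow_one]
    rfl
  rintro _ ⟨j, rfl⟩
  induction j with
  | zero => exact ⟨0, rfl⟩
  | succ j ih => exact (hstep j).1 ih
  | pred j ih => exact (hstep _).2 (by simpa using ih)

theorem shannonOrbitEquivalent_of_tame [StandardBorelSpace X] [IsFiniteMeasure μ] {T U : Aut μ}
    (hT : Aperiodic T) (hTU : Tame μ (T : Equiv.Perm X) U) (hUT : Tame μ (U : Equiv.Perm X) T) :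
    SameOrbits T U ∧ ShannonOrbitEquivalent T U := by
  have hsame : SameOrbits T U := by
    filter_upwards [hTU.ae_orbit_subset, hUT.ae_orbit_subset] with x h1 h2
    exact h2.antisymm h1
  refine ⟨hsame, hT, ?_, 1, ?_, ?_, ?_⟩
  · filter_upwards [hT, hsame] with x hx h
    rwa [← h]
  · simpa using hsame
  · simpa using hUT.exists_cocycle
  · simpa using hTU.exists_cocycle

theorem Conjugate.ae_pow {T U S : Aut μ} (hS : ∀ᵐ x ∂μ, S (T x) = U (S x)) (n : ℕ) :
    ∀ᵐ x ∂μ, S ((T ^ n) x) = (U ^ n) (S x) := by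
  induction n with
  | zero => exact .of_forall fun x => rfl
  | succ n ih =>
    filter_upwards [hS, T.2.1.quasiMeasurePreserving.ae ih] with x hx hxn
    rw [pow_succ, pow_succ]
    exact hxn.trans (congrArg _ hx)

/-- A conjugacy would pull `A` back to an almost `T ^ n`-invariant set that is neither null nor
conull. -/
theorem not_conjugate_of_ergodic_pow {T U : Aut μ} {n : ℕ} (hT : Ergodic (T ^ n : Aut μ) μ)
    {A : Set X} (hA : MeasurableSet A) (h0 : μ A ≠ 0) (h1 : μ Aᶜ ≠ 0)
    (hUA : (U ^ n : Aut μ) ⁻¹' A =ᵐ[μ] A) : ¬ Conjugate T U := by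
  rintro ⟨S, hS⟩
  have hpow := Conjugate.ae_pow hS n
  have hSA : MeasurableSet (S ⁻¹' A) := measurable_of_mem_Aut S.2 hA
  have hinv : (T ^ n : Aut μ) ⁻¹' (S ⁻¹' A) =ᵐ[μ] S ⁻¹' A := by
    refine Filter.EventuallyEq.trans ?_ (S.2.1.quasiMeasurePreserving.preimage_ae_eq hUA)
    refine Filter.eventuallyEq_set.2 ?_
    filter_upwards [hpow] with x hx
    simp only [Set.mem_preimage, hx]
  rcases hT.quasiErgodic.ae_empty_or_univ₀ hSA.nullMeasurableSet hinv with h | h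
  · rw [ae_eq_empty, S.2.1.measure_preimage hA.nullMeasurableSet] at h
    exact h0 h
  · rw [ae_eq_univ, ← Set.preimage_compl, S.2.1.measure_preimage hA.compl.nullMeasurableSet] at h
    exact h1 h

theorem ergodic_inv {T : Aut μ} (hT : Ergodic T μ) : Ergodic (T⁻¹ : Aut μ) μ :=
  Ergodic.symm (e := ⟨(T : Equiv.Perm X), T.2.1.measurable, T.2.2.measurable⟩) hT

theorem not_flipConjugate_of_ergodic_pow {T U : Aut μ} {n : ℕ}
    (hT : Ergodic (T ^ n : Aut μ) μ)
    {A : Set X} (hA : MeasurableSet A) (h0 : μ A ≠ 0) (h1 : μ Aᶜ ≠ 0)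
    (hUA : (U ^ n : Aut μ) ⁻¹' A =ᵐ[μ] A) : ¬ FlipConjugate T U := by
  rintro (h | h)
  · exact not_conjugate_of_ergodic_pow hT hA h0 h1 hUA h
  · refine not_conjugate_of_ergodic_pow (n := n) ?_ hA h0 h1 hUA h
    rw [inv_pow]
    exact ergodic_inv hT

/-- A `U`-invariant set is a union of `U`-orbits, and `T x` lies on the `U`-orbit of `x` almost
surely. -/
theorem SameOrbits.ergodic {T U : Aut μ} (h : SameOrbits T U) (hT : Ergodic T μ) :
    Ergodic U μ where
  toMeasurePreserving := U.2.1
  aeconst_set := by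
    intro s hs hUs
    refine hT.quasiErgodic.aeconst_set₀ hs.nullMeasurableSet (Filter.eventuallyEq_set.2 ?_)
    have hstep : ∀ y, U y ∈ s ↔ y ∈ s := fun y => by
      conv_rhs => rw [← hUs]
      rfl
    filter_upwards [h] with x hx
    have hstep' : ∀ j : ℤ, (U ^ (j + 1)) x ∈ s ↔ (U ^ j) x ∈ s := fun j => by
      rw [add_comm, zpow_add, zpow_one]
      exact hstep _
    obtain ⟨k, hk⟩ : T x ∈ orbit U x := hx ▸ ⟨1, by simp⟩
    have hk' : (U ^ k) x = T x := hk
    rw [Set.mem_preimage, ← hk']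
    clear hk hk'
    induction k with
    | zero => exact Iff.rfl
    | succ k ih => exact (hstep' k).trans ih
    | pred k ih => exact (hstep' _).symm.trans (by rwa [sub_add_cancel])

theorem ae_pow_apply_ne [StandardBorelSpace X] [IsProbabilityMeasure μ] [NullSingletonClass μ]
    {T : Aut μ} (hT : Ergodic T μ) :
    ∀ᵐ x ∂μ, ∀ k : ℕ, 0 < k → ((T : Equiv.Perm X) ^ k) x ≠ x := by
  refine ae_all_iff.2 fun k => ?_
  rcases k with _ | m
  · simp
  set τ : Equiv.Perm X := (T : Equiv.Perm X)
  have hτ : ∀ i : ℕ, τ ^ i ∈ Aut μ := fun i => pow_mem T.2 i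
  have hP : MeasurableSet {x | (τ ^ (m + 1)) x = x} :=
    measurableSet_eq_fun (hτ _).1.measurable measurable_id
  have hcomm : ∀ (i : ℕ) x, (τ ^ i) (τ x) = τ ((τ ^ i) x) := fun i x => by
    rw [← Equiv.Perm.mul_apply, ← Equiv.Perm.mul_apply, ← pow_succ, ← pow_succ']
  have hinv : τ ⁻¹' {x | (τ ^ (m + 1)) x = x} = {x | (τ ^ (m + 1)) x = x} := by
    ext x
    simp only [Set.mem_preimage, Set.mem_ofPred_eq]
    rw [hcomm, τ.apply_eq_iff_eq]
  rcases hT.toPreErgodic.ae_empty_or_univ hP hinv with h | h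
  · rw [ae_eq_empty] at h
    filter_upwards [measure_eq_zero_iff_ae_notMem.1 h] with x hx _
    exact hx
  exfalso
  have hper : ∀ᵐ x ∂μ, (τ ^ (m + 1)) x = x := by
    filter_upwards [h] with x hx
    exact (iff_of_eq hx).2 trivial
  have hf := measurableEmbedding_embeddingReal X
  set f := embeddingReal X
  -- If almost every point has period `m + 1`, the minimum of an injective real coordinate over a
  -- period is invariant, hence constant. Almost every orbit then meets a single level set of `f`,
  -- which is at most one point and so null.
  set g : X → ℝ := fun x => ⨅ i : Fin (m + 1), f ((τ ^ (i : ℕ)) x) with hg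
  have hgm : Measurable g := Measurable.iInf fun i => hf.measurable.comp (hτ i).1.measurable
  have hgT : g ∘ τ =ᵐ[μ] g := by
    filter_upwards [hper] with x hx
    refine (finRotate (m + 1)).iInf_congr fun i => ?_
    rw [hcomm, ← Equiv.Perm.mul_apply, ← pow_succ']
    rcases (Nat.lt_succ_iff.1 i.2).lt_or_eq with hi | hi
    · rw [show i = ⟨i, by lia⟩ from rfl, finRotate_of_lt hi]
    · obtain rfl : i = Fin.last m := Fin.ext hi
      rw [finRotate_last, Fin.val_last, hx]
      rfl
  obtain ⟨c, hc⟩ := hT.quasiErgodic.ae_eq_const_of_ae_eq_comp₀ hgm.nullMeasurable hgT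
  have hnull : ∀ᵐ x ∂μ, ∀ i : ℕ, f ((τ ^ i) x) ≠ c := by
    refine ae_all_iff.2 fun i => (hτ i).1.quasiMeasurePreserving.ae (p := fun y => f y ≠ c) ?_
    exact measure_eq_zero_iff_ae_notMem.1
      ((Set.subsingleton_singleton.preimage hf.injective).measure_zero μ)
  obtain ⟨x, hx, hxc⟩ := (hnull.and hc).exists
  obtain ⟨i, hi⟩ := exists_eq_ciInf_of_finite (f := fun i : Fin (m + 1) => f ((τ ^ (i : ℕ)) x))
  exact hx i (hi.trans hxc)

theorem aperiodic_of_ae_pow_apply_ne {T : Aut μ}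
    (h : ∀ᵐ x ∂μ, ∀ k : ℕ, 0 < k → ((T : Equiv.Perm X) ^ k) x ≠ x) : Aperiodic T := by
  filter_upwards [h] with x hx
  have key : ∀ i j : ℤ, i < j → (T ^ i) x ≠ (T ^ j) x := by
    intro i j hij hij'
    refine hx (j - i).toNat (by lia) ?_
    have h1 : ((j - i).toNat : ℤ) = -i + j := by lia
    rw [← zpow_natCast, h1, zpow_add, zpow_neg, Equiv.Perm.mul_apply, Equiv.Perm.inv_eq_iff_eq]
    simpa using hij'.symm
  refine Set.infinite_range_of_injective fun i j hij => ?_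
  rcases lt_trichotomy i j with h | h | h
  · exact absurd hij (key i j h)
  · exact h
  · exact absurd hij.symm (key j i h)

theorem exists_sameOrbits_not_flipConjugate [StandardBorelSpace X] [IsProbabilityMeasure μ]
    [NullSingletonClass μ] {T : Aut μ} (hT : Ergodic T μ) {n : ℕ} (hn : 2 ≤ n)
    (hTn : Ergodic (T ^ n : Aut μ) μ) :
    ∃ U : Aut μ, SameOrbits T U ∧ ShannonOrbitEquivalent T U ∧ ¬ FlipConjugate T U := by
  have hfree := ae_pow_apply_ne hT
  obtain ⟨U, hU, hTU, hUT, A, hA, h0, h1, hUA⟩ := exists_tame_not_ergodic_pow T.2 hfree hn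
  obtain ⟨hs, hoe⟩ := shannonOrbitEquivalent_of_tame (U := ⟨U, hU⟩)
    (aperiodic_of_ae_pow_apply_ne hfree) hTU hUT
  exact ⟨⟨U, hU⟩, hs, hoe, not_flipConjugate_of_ergodic_pow hTn hA h0 h1 hUA⟩

end Orbits

/-! ### An example: an irrational rotation, with `n = 2`. -/

section Rotation

instance : IsProbabilityMeasure (volume : Measure UnitAddCircle) := ⟨by simp⟩

theorem addOrderOf_sqrt_two : addOrderOf ((√2 : ℝ) : UnitAddCircle) = 0 := by
  rw [← AddCircle.denseRange_zsmul_iff, AddCircle.denseRange_zsmul_coe_iff]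
  simpa using irrational_sqrt_two

/-- By translation invariance an atom would give infinitely many points the same positive mass. -/
instance : NullSingletonClass (volume : Measure UnitAddCircle) where
  measure_singleton x := by
    have : Infinite UnitAddCircle := Infinite.of_injective
      (fun n : ℕ => n • ((√2 : ℝ) : UnitAddCircle))
      (injective_nsmul_iff_not_isOfFinAddOrder.2 (addOrderOf_eq_zero_iff.1 addOrderOf_sqrt_two))
    by_contra h
    refine measure_ne_top (volume : Measure UnitAddCircle) Set.univ
      (Set.infinite_univ.meas_eq_top ⟨_, h, fun y _ => ?_⟩)
    rw [← measure_preimage_add volume (x - y) {x}]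
    exact measure_mono fun z hz => by
      rw [Set.mem_singleton_iff]
      exact add_left_cancel ((show x - y + z = x from hz).trans (sub_add_cancel x y).symm)

/-- The rotation of the circle by `a`. -/
def rotation (a : UnitAddCircle) : Aut (volume : Measure UnitAddCircle) :=
  ⟨Equiv.addLeft a, measurePreserving_add_left volume a, measurePreserving_add_left volume (-a)⟩

theorem ergodic_rotation {a : UnitAddCircle} (ha : addOrderOf a = 0) :
    Ergodic (rotation a) volume := AddCircle.ergodic_add_left.2 ha

theorem rotation_pow_two (a : UnitAddCircle) : rotation a ^ 2 = rotation (2 • a) := by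
  ext x
  simp [rotation, pow_two, two_nsmul]

end Rotation

end ShannonOE

theorem mainTheorem3 :
    (∀ {X : Type*} [MeasurableSpace X] [StandardBorelSpace X] (μ : Measure X)
        [IsProbabilityMeasure μ] [NullSingletonClass μ] (T : ShannonOE.Aut μ),
        Ergodic T μ → (∃ n : ℕ, 2 ≤ n ∧ Ergodic (T ^ n : ShannonOE.Aut μ) μ) →
        ∃ U : ShannonOE.Aut μ,
          ShannonOE.ShannonOrbitEquivalent T U ∧ ¬ ShannonOE.FlipConjugate T U) ∧
    (∃ (X : Type) (_ : MeasurableSpace X) (_ : StandardBorelSpace X) (μ : Measure X)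
        (_ : IsProbabilityMeasure μ) (_ : NullSingletonClass μ) (T U : ShannonOE.Aut μ),
        Ergodic T μ ∧ Ergodic U μ ∧
          ShannonOE.ShannonOrbitEquivalent T U ∧ ¬ ShannonOE.FlipConjugate T U) := by
  constructor
  · rintro X _ _ μ _ _ T hT ⟨n, hn, hTn⟩
    obtain ⟨U, -, hU⟩ := ShannonOE.exists_sameOrbits_not_flipConjugate hT hn hTn
    exact ⟨U, hU⟩
  · have hT := ShannonOE.ergodic_rotation ShannonOE.addOrderOf_sqrt_two
    -- The square is the rotation by `2 • √2`, which again has infinite order.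
    have hT2 : Ergodic (ShannonOE.rotation ((√2 : ℝ) : UnitAddCircle) ^ 2 : ShannonOE.Aut volume)
        volume := by
      rw [ShannonOE.rotation_pow_two]
      refine ShannonOE.ergodic_rotation ?_
      have h := ShannonOE.addOrderOf_sqrt_two
      rw [addOrderOf_eq_zero_iff] at h ⊢
      simpa [isOfFinAddOrder_nsmul] using h
    obtain ⟨U, hs, hU⟩ := ShannonOE.exists_sameOrbits_not_flipConjugate hT le_rfl hT2
    exact ⟨UnitAddCircle, inferInstance, inferInstance, volume, inferInstance, inferInstance, _, U,
      hT, hs.ergodic hT, hU⟩
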